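/- Let $(\Omega,\Sigma,\mu)$ be a $\sigma$-finite measure space; all function spaces below consist of ($\mu$-a.e. equivalence classes of) real-valued, or of complex-valued, measurable functions on $\Omega$. For Banach function spaces $X_0,X_1$ on $\Omega$ let $\mathcal A(X_0,X_1)$ be the set of all maps $T:X_0+X_1\to X_0+X_1$ such that $|T(x+y)|\le |Tx|+|Ty|$ a.e. for all $x,y\in X_0+X_1$ (subadditivity), $T(X_i)\subset X_i$ and $M_i:=\sup_{0\ne x\in X_i}\|Tx\|_{X_i}/\|x\|_{X_i}<\infty$ for $i=0,1$; put $M:=\max\{M_0,M_1\}$. A Banach space $X$ is an interpolation space for subadditive operators between $X_0$ and $X_1$ with constant $C$ if $X_0\cap X_1\subset X\subset X_0+X_1$ with continuous embeddings and every $T\in\mathcal A(X_0,X_1)$ maps $X$ into itself with $\|T\|_{X\to X}:=\sup_{0\ne x\in X}\|Tx\|_X/\|x\|_X\le CM$. An Orlicz function is a nondecreasing convex function $\varphi:[0,\infty)\to[0,\infty]$ with $\varphi(0)=0$ and $\lim_{u\to0+}\varphi(u)=0$ that is neither identically $0$ nor identically $\infty$ on $(0,\infty)$. Put $I_\varphi(x):=\int_\Omega\varphi(|x|)\,d\mu$;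 the Orlicz space $L^\varphi$ consists of all $x$ with $I_\varphi(\lambda x)<\infty$ for some $\lambda>0$; its Luxemburg–Nakano norm is $\inf\{\lambda>0: I_\varphi(x/\lambda)\le1\}$ and its Orlicz norm is $\inf_{k>0}\frac1k\bigl(1+I_\varphi(kx)\bigr)$. Let $1\le p<\infty$. (a) Let $\varphi$ be a left-continuous Orlicz function such that $u\mapsto\varphi(u^{1/p})$ is convex, and let $T\in\mathcal A(L^p,L^\infty)$. Then $$I_\varphi\left(\frac{Tx}{2^{1-1/p}M}\right)\le I_\varphi(x)\qquad\text{for all }x\in L^p+L^\infty,$$ where the quotient is read as $0$ if $M=0$ (in which case $Tx=0$ a.e.). (b) Let $\rho:[0,\infty)\to[0,\infty)$ be concave, continuous and positive on $(0,\infty)$, with $\rho(s)\le\max(1,s/t)\,\rho(t)$ for all $s,t>0$, and suppose that $\rho_*(t):=t\rho(1/t)$ maps $(0,\infty)$ onto $(0,\infty)$. Let $\varphi$ be the function with $\varphi(0)=0$ and $\varphi^{-1}(u)=u^{1/p}\rho(u^{-1/p})$ for all $u>0$. Then $\varphi$ is an Orlicz function, and $L^\varphi$, both with the Luxemburg–Nakano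 norm and with the Orlicz norm, is an interpolation space for subadditive operators between $L^p$ and $L^\infty$ with constant $2^{1-1/p}$; that is, $\|T\|_{L^\varphi\to L^\varphi}\le 2^{1-1/p}\max\{\|T\|_{L^p\to L^p},\|T\|_{L^\infty\to L^\infty}\}$ for every $T\in\mathcal A(L^p,L^\infty)$. In particular, for $p=1$ the constant is $1$. -/

import Mathlib

open MeasureTheory Set Filter Topology
open scoped NNReal ENNReal Pointwise

/-- `φ : [0,∞) → [0,∞]` is an Orlicz function: nondecreasing, convex, `φ(0) = 0`,
`φ(u) → 0` as `u → 0+`, and neither identically zero nor identically infinite on `(0,∞)`. -/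
structure IsOrliczFunction (φ : ℝ≥0 → ℝ≥0∞) : Prop where
  mono : Monotone φ
  convex : ConvexOn ℝ≥0 univ φ
  map_zero : φ 0 = 0
  tendsto_zero : Tendsto φ (𝓝[>] 0) (𝓝 0)
  not_zero : ∃ u, 0 < u ∧ φ u ≠ 0
  not_top : ∃ u, 0 < u ∧ φ u ≠ ⊤

/-- Left continuity of `φ : [0,∞) → [0,∞]` at every point. -/
def IsLeftContinuous (φ : ℝ≥0 → ℝ≥0∞) : Prop :=
  ∀ u, ContinuousWithinAt φ (Iio u) u

/-- `ρ : [0,∞) → [0,∞)` is quasi-concave. -/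
structure IsQuasiConcave (ρ : ℝ≥0 → ℝ≥0) : Prop where
  continuousOn : ContinuousOn ρ (Ioi 0)
  pos : ∀ t, 0 < t → 0 < ρ t
  le_max_mul : ∀ s t, 0 < s → 0 < t → ρ s ≤ max 1 (s / t) * ρ t

/-- `ρ` is quasi-concave and concave. -/
def IsConcaveQuasiConcave (ρ : ℝ≥0 → ℝ≥0) : Prop :=
  IsQuasiConcave ρ ∧ ConcaveOn ℝ≥0 univ ρ

/-- `ρ_*(t) = t ρ(1/t)`. -/
noncomputable def rhoStar (ρ : ℝ≥0 → ℝ≥0) (t : ℝ≥0) : ℝ≥0 :=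
  t * ρ (1 / t)

/-- A set of (classes of a.e. equal) functions on `Ω`, together with a functional which plays
the role of the norm on that set; the values of the functional off the set are never used. -/
structure FnSpace {Ω : Type*} [MeasurableSpace Ω] (𝕜 : Type*) [RCLike 𝕜] (μ : Measure Ω) where
  carrier : Set (Ω →ₘ[μ] 𝕜)
  nrm : (Ω →ₘ[μ] 𝕜) → ℝ≥0∞

section

variable {Ω : Type*} [MeasurableSpace Ω] {𝕜 : Type*} [RCLike 𝕜] {μ : Measure Ω}

/-- The modular `I_φ(x) = ∫ φ(|x(t)|) dμ(t)`. -/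
noncomputable def modular (φ : ℝ≥0 → ℝ≥0∞) (x : Ω →ₘ[μ] 𝕜) : ℝ≥0∞ :=
  ∫⁻ t, φ ‖x t‖₊ ∂μ

/-- The set underlying the Orlicz space `L^φ`. -/
def orliczCarrier (φ : ℝ≥0 → ℝ≥0∞) : Set (Ω →ₘ[μ] 𝕜) :=
  {x | ∃ l : ℝ, 0 < l ∧ modular φ (l • x) < ⊤}

/-- The Luxemburg–Nakano norm. -/
noncomputable def luxemburgNorm (φ : ℝ≥0 → ℝ≥0∞) (x : Ω →ₘ[μ] 𝕜) : ℝ≥0∞ :=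
  ⨅ (l : ℝ) (_ : 0 < l) (_ : modular φ (l⁻¹ • x) ≤ 1), ENNReal.ofReal l

/-- The Orlicz norm in the Amemiya form. -/
noncomputable def orliczNorm (φ : ℝ≥0 → ℝ≥0∞) (x : Ω →ₘ[μ] 𝕜) : ℝ≥0∞ :=
  ⨅ (k : ℝ) (_ : 0 < k), (ENNReal.ofReal k)⁻¹ * (1 + modular φ (k • x))

namespace FnSpace

/-- The Lebesgue space `L^p`. -/
noncomputable def lebesgue (𝕜 : Type*) [RCLike 𝕜] (μ : Measure Ω) (p : ℝ≥0∞) : FnSpace 𝕜 μ where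
  carrier := {x | x ∈ Lp 𝕜 p μ}
  nrm x := eLpNorm x p μ

/-- The Orlicz space `L^φ` with the Luxemburg–Nakano norm. -/
noncomputable def orliczLuxemburg (𝕜 : Type*) [RCLike 𝕜] (μ : Measure Ω) (φ : ℝ≥0 → ℝ≥0∞) :
    FnSpace 𝕜 μ where
  carrier := orliczCarrier φ
  nrm := luxemburgNorm φ

/-- The Orlicz space `L^φ` with the Orlicz norm. -/
noncomputable def orliczAmemiya (𝕜 : Type*) [RCLike 𝕜] (μ : Measure Ω) (φ : ℝ≥0 → ℝ≥0∞) :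
    FnSpace 𝕜 μ where
  carrier := orliczCarrier φ
  nrm := orliczNorm φ

/-- `X` is a Banach space: a linear subspace of the space of classes of measurable functions
on which `nrm` is a (finite) complete norm. -/
structure IsBanach (X : FnSpace 𝕜 μ) : Prop where
  zero_mem : 0 ∈ X.carrier
  add_mem : ∀ x ∈ X.carrier, ∀ y ∈ X.carrier, x + y ∈ X.carrier
  smul_mem : ∀ (c : 𝕜), ∀ x ∈ X.carrier, c • x ∈ X.carrier
  nrm_lt_top : ∀ x ∈ X.carrier, X.nrm x < ⊤
  nrm_eq_zero_iff : ∀ x ∈ X.carrier, X.nrm x = 0 ↔ x = 0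
  nrm_add_le : ∀ x ∈ X.carrier, ∀ y ∈ X.carrier, X.nrm (x + y) ≤ X.nrm x + X.nrm y
  nrm_smul : ∀ (c : 𝕜), ∀ x ∈ X.carrier, X.nrm (c • x) = ‖c‖ₑ * X.nrm x
  complete : ∀ u : ℕ → (Ω →ₘ[μ] 𝕜), (∀ n, u n ∈ X.carrier) →
    (∀ ε : ℝ≥0∞, 0 < ε → ∃ n₀, ∀ m ≥ n₀, ∀ n ≥ n₀, X.nrm (u m - u n) < ε) →
    ∃ x ∈ X.carrier, Tendsto (fun n => X.nrm (u n - x)) atTop (𝓝 0)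

/-- The set underlying the sum `X₀ + X₁`. -/
def sum (X₀ X₁ : FnSpace 𝕜 μ) : Set (Ω →ₘ[μ] 𝕜) := X₀.carrier + X₁.carrier

/-- The norm of the intersection `X₀ ∩ X₁`. -/
noncomputable def interNrm (X₀ X₁ : FnSpace 𝕜 μ) (x : Ω →ₘ[μ] 𝕜) : ℝ≥0∞ :=
  max (X₀.nrm x) (X₁.nrm x)

/-- The norm of the sum `X₀ + X₁`. -/
noncomputable def sumNrm (X₀ X₁ : FnSpace 𝕜 μ) (x : Ω →ₘ[μ] 𝕜) : ℝ≥0∞ :=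
  ⨅ (x₀ ∈ X₀.carrier) (x₁ ∈ X₁.carrier) (_ : x = x₀ + x₁), X₀.nrm x₀ + X₁.nrm x₁

/-- `T : X₀ + X₁ → X₀ + X₁` is subadditive. -/
def IsSubadditive {X₀ X₁ : FnSpace 𝕜 μ} (T : sum X₀ X₁ → sum X₀ X₁) : Prop :=
  ∀ x y z : sum X₀ X₁, z.1 = x.1 + y.1 →
    ∀ᵐ t ∂μ, ‖(T z).1 t‖ ≤ ‖(T x).1 t‖ + ‖(T y).1 t‖

/-- The operator norm `‖T‖_{X → X} = sup { ‖Tx‖_X / ‖x‖_X : x ∈ X, x ≠ 0 }` of the restriction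
to `X` of an operator on `X₀ + X₁`. -/
noncomputable def opNrm {X₀ X₁ : FnSpace 𝕜 μ} (T : sum X₀ X₁ → sum X₀ X₁) (X : FnSpace 𝕜 μ) :
    ℝ≥0∞ :=
  ⨆ (x : sum X₀ X₁) (_ : x.1 ∈ X.carrier) (_ : x.1 ≠ 0), X.nrm (T x).1 / X.nrm x.1

/-- `T` maps `X` into itself. -/
def MapsInto {X₀ X₁ : FnSpace 𝕜 μ} (T : sum X₀ X₁ → sum X₀ X₁) (X : FnSpace 𝕜 μ) : Prop :=
  ∀ x : sum X₀ X₁, x.1 ∈ X.carrier → (T x).1 ∈ X.carrier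

/-- The class of admissible operators: subadditive operators on `X₀ + X₁` whose restrictions
to `X₀` and `X₁` are bounded operators of these spaces into themselves. -/
structure IsAdmissible {X₀ X₁ : FnSpace 𝕜 μ} (T : sum X₀ X₁ → sum X₀ X₁) : Prop where
  subadditive : IsSubadditive T
  mapsInto₀ : MapsInto T X₀
  mapsInto₁ : MapsInto T X₁
  bounded₀ : opNrm T X₀ < ⊤
  bounded₁ : opNrm T X₁ < ⊤

/-- `M = max (‖T‖_{X₀ → X₀}, ‖T‖_{X₁ → X₁})`. -/
noncomputable def maxNrm {X₀ X₁ : FnSpace 𝕜 μ} (T : sum X₀ X₁ → sum X₀ X₁) : ℝ≥0∞ :=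
  max (opNrm T X₀) (opNrm T X₁)

/-- The Banach space `X` is an interpolation space for subadditive operators between `X₀` and
`X₁`, with interpolation constant `C`. -/
structure IsInterpolationSpace (X₀ X₁ X : FnSpace 𝕜 μ) (C : ℝ≥0∞) : Prop where
  banach : X.IsBanach
  inter_subset : X₀.carrier ∩ X₁.carrier ⊆ X.carrier
  inter_continuous : ∃ c : ℝ≥0, ∀ x ∈ X₀.carrier ∩ X₁.carrier, X.nrm x ≤ c * interNrm X₀ X₁ x
  subset_sum : X.carrier ⊆ sum X₀ X₁
  sum_continuous : ∃ c : ℝ≥0, ∀ x ∈ X.carrier, sumNrm X₀ X₁ x ≤ c * X.nrm x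
  mapsInto : ∀ T : sum X₀ X₁ → sum X₀ X₁, IsAdmissible T → MapsInto T X
  opNrm_le : ∀ T : sum X₀ X₁ → sum X₀ X₁, IsAdmissible T → opNrm T X ≤ C * maxNrm T

end FnSpace

end

/-! (a) Truncating `x` radially at level `l` writes `x = x₀ + x₁` with `|x₁| ≤ l` and `|x₀| ≤ (|x| -
l)₊`. If `K` bounds `T` on both end spaces, subadditivity gives `|Tx| ≤ |Tx₀| + K l` a.e., and `(a +
b)^p ≤ 2^(p-1) (a^p + b^p)` turns this into `(|Tx| / (2^(1-1/p) K))^p - l^p ≤ (|Tx₀| / K)^p`.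
Integrating, using the `L^p` bound for `x₀` and `(a - l)^p ≤ a^p - l^p` for `a ≥ l`, yields with `s
= l^p` `∫ ((|Tx| / (2^(1-1/p) K))^p - s)₊ ≤ ∫ (|x|^p - s)₊` for every `s ≥ 0`
(`FnSpace.lintegral_tsub_apply_le`). A left-continuous convex function vanishing at `0` is a mixture
of the functions `u ↦ (u - s)₊` (`exists_eq_lintegral_sub`), so the comparison passes to `ψ(u) = φ(c
u^(1/p))` for every scale `c` (`modular_smul_apply_le`).

(b) Here `φ(ρ_*(w)) = w^p`, so `u ↦ φ(u^(1/p))` is the inverse of `t ↦ ρ_*(t^(1/p))^p`. The latter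
is concave: at each point `ρ_*` is touched from above by an affine function `k t + d` with `k, d ≥
0`, and `(k t^(1/p) + d)^p` is concave by Minkowski's inequality (`rhoStar_rpow_mean_le`). The
modular estimate at all scales then bounds both norms, since each is an infimum over `l` of `l
W(I_φ(x/l))` with a monotone weight `W`. Treating a general weight handles the two norms at once. -/

/-! ### Convex functions as mixtures of truncations -/

/-- A convex nondecreasing function on `[0,∞)` with values in `[0,∞]`, extended by its value at `0`
to the negative half-line, is convex as a real function to the left of any point where it is
finite. -/
theorem convexOn_toReal_Iic {ψ : ℝ≥0 → ℝ≥0∞} (hm : Monotone ψ) (hc : ConvexOn ℝ≥0 univ ψ)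
    {v : ℝ≥0} (hv : ψ v ≠ ⊤) :
    ConvexOn ℝ (Iic (v : ℝ)) (fun t : ℝ => (ψ t.toNNReal).toReal) := by
  have fin : ∀ t : ℝ, t ≤ v → ψ t.toNNReal ≠ ⊤ := fun t ht =>
    ne_top_of_le_ne_top hv (hm (Real.toNNReal_le_iff_le_coe.2 ht))
  refine ⟨convex_Iic _, fun x hx y hy a b ha hb hab => ?_⟩
  lift a to ℝ≥0 using ha
  lift b to ℝ≥0 using hb
  have hab' : a + b = 1 := by exact_mod_cast hab
  have h1 : ((a : ℝ) • x + (b : ℝ) • y).toNNReal ≤ a • x.toNNReal + b • y.toNNReal := by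
    refine Real.toNNReal_le_iff_le_coe.2 ?_
    simp only [smul_eq_mul, NNReal.coe_add, NNReal.coe_mul]
    gcongr <;> exact Real.le_coe_toNNReal _
  have h2 := (hm h1).trans (hc.2 (mem_univ _) (mem_univ _) zero_le zero_le hab')
  have h3 : a • ψ x.toNNReal + b • ψ y.toNNReal ≠ ⊤ :=
    ENNReal.add_ne_top.2 ⟨ENNReal.mul_ne_top ENNReal.coe_ne_top (fin x hx),
      ENNReal.mul_ne_top ENNReal.coe_ne_top (fin y hy)⟩
  have h4 := ENNReal.toReal_mono h3 h2
  refine h4.trans_eq ?_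
  rw [ENNReal.toReal_add]
  · simp [ENNReal.smul_def, ENNReal.toReal_mul]
  · exact ENNReal.mul_ne_top ENNReal.coe_ne_top (fin x hx)
  · exact ENNReal.mul_ne_top ENNReal.coe_ne_top (fin y hy)

open Classical in
/-- The right derivative of a convex function with values in `[0,∞]`, equal to `∞` at the points
to the right of which the function is infinite. -/
noncomputable def extendedRightDeriv (ψ : ℝ≥0 → ℝ≥0∞) (t : ℝ) : ℝ≥0∞ :=
  if ∃ v : ℝ≥0, t < v ∧ ψ v ≠ ⊤ then
    ENNReal.ofReal (derivWithin (fun t : ℝ => (ψ t.toNNReal).toReal) (Ioi t) t) else ⊤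

theorem monotone_extendedRightDeriv {ψ : ℝ≥0 → ℝ≥0∞} (hm : Monotone ψ)
    (hc : ConvexOn ℝ≥0 univ ψ) : Monotone (extendedRightDeriv ψ) := by
  intro s t hst
  by_cases ht : ∃ v : ℝ≥0, t < v ∧ ψ v ≠ ⊤
  · have hs : ∃ v : ℝ≥0, s < v ∧ ψ v ≠ ⊤ := ht.imp fun v hv => ⟨hst.trans_lt hv.1, hv.2⟩
    rw [extendedRightDeriv, extendedRightDeriv, if_pos hs, if_pos ht]
    obtain ⟨v, hv, hv'⟩ := ht
    refine ENNReal.ofReal_le_ofReal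
      ((convexOn_toReal_Iic hm hc hv').monotoneOn_rightDeriv ?_ ?_ hst)
    · rw [interior_Iic]; exact hst.trans_lt hv
    · rw [interior_Iic]; exact hv
  · rw [extendedRightDeriv, extendedRightDeriv, if_neg ht]
    exact le_top

/-- The constant extension to the left of `0` and the gap `u < v` put all of `[0, u]` in the
interior of a domain of finite convexity. There the function is continuous and has a right
derivative, and the fundamental theorem of calculus for right derivatives applies. -/
theorem eq_lintegral_extendedRightDeriv_of_lt {ψ : ℝ≥0 → ℝ≥0∞} (hm : Monotone ψ)
    (hc : ConvexOn ℝ≥0 univ ψ) (h0 : ψ 0 = 0) {u v : ℝ≥0} (huv : u < v) (hv : ψ v ≠ ⊤) :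
    ψ u = ∫⁻ t in Ioo 0 (u : ℝ), extendedRightDeriv ψ t := by
  set P : ℝ → ℝ := fun t : ℝ => (ψ t.toNNReal).toReal with hP
  have hconv := convexOn_toReal_Iic hm hc hv
  have huv' : (u : ℝ) < v := by exact_mod_cast huv
  have hint : interior (Iic (v : ℝ)) = Iio (v : ℝ) := interior_Iic
  have hsub : Icc 0 (u : ℝ) ⊆ interior (Iic (v : ℝ)) := by
    rw [hint]; exact fun t ht => ht.2.trans_lt huv'
  have hcont : ContinuousOn P (Icc 0 (u : ℝ)) := by
    exact (hconv.continuousOn_interior).mono hsub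
  have hmono : MonotoneOn (fun x ↦ derivWithin P (Ioi x) x) (Icc 0 (u : ℝ)) :=
    hconv.monotoneOn_rightDeriv.mono hsub
  have hi : IntervalIntegrable (fun x ↦ derivWithin P (Ioi x) x) volume 0 u := by
    refine MonotoneOn.intervalIntegrable ?_
    rwa [uIcc_of_le u.coe_nonneg]
  have ftc := intervalIntegral.integral_eq_sub_of_hasDeriv_right_of_le u.coe_nonneg hcont
    (fun x hx => hconv.hasDerivWithinAt_rightDeriv_of_mem_interior (hsub ⟨hx.1.le, hx.2.le⟩)) hi
  have hP0 : P 0 = 0 := by simp [hP, h0]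
  have hPm : MonotoneOn P (Iic (v : ℝ)) := fun s hs t ht hst =>
    ENNReal.toReal_mono (ne_top_of_le_ne_top hv (hm (Real.toNNReal_le_iff_le_coe.2 ht)))
      (hm (Real.toNNReal_le_toNNReal hst))
  have hnn : ∀ t ∈ Ioo 0 (u : ℝ), 0 ≤ derivWithin P (Ioi t) t := by
    intro t ht
    have hd := hconv.hasDerivWithinAt_rightDeriv_of_mem_interior (hsub ⟨ht.1.le, ht.2.le⟩)
    refine ge_of_tendsto (hasDerivWithinAt_iff_tendsto_slope' (by simp) |>.1 hd) ?_
    have : Ioo t (v : ℝ) ∈ 𝓝[>] t := Ioo_mem_nhdsGT (ht.2.trans huv')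
    filter_upwards [this] with z hz
    rw [slope_def_field]
    exact div_nonneg (sub_nonneg.2 (hPm (ht.2.trans huv').le hz.2.le hz.1.le))
      (sub_nonneg.2 hz.1.le)
  have hu : ψ u ≠ ⊤ := ne_top_of_le_ne_top hv (hm huv.le)
  calc ψ u = ENNReal.ofReal (P u) := by simp [hP, ENNReal.ofReal_toReal hu]
    _ = ENNReal.ofReal (∫ t in Ioo 0 (u : ℝ), derivWithin P (Ioi t) t) := by
        rw [← integral_Ioc_eq_integral_Ioo, ← intervalIntegral.integral_of_le u.coe_nonneg, ftc, hP0,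
          sub_zero]
    _ = ∫⁻ t in Ioo 0 (u : ℝ), ENNReal.ofReal (derivWithin P (Ioi t) t) := by
        refine ofReal_integral_eq_lintegral_ofReal ?_ ?_
        · exact ((intervalIntegrable_iff_integrableOn_Ioo_of_le u.coe_nonneg).1 hi)
        · exact (ae_restrict_mem measurableSet_Ioo).mono hnn
    _ = _ := by
        refine setLIntegral_congr_fun measurableSet_Ioo fun t ht => ?_
        rw [extendedRightDeriv, if_pos ⟨v, ht.2.trans huv', hv⟩]

/-- A left-continuous convex function is the integral of its right derivative. -/
theorem eq_lintegral_extendedRightDeriv {ψ : ℝ≥0 → ℝ≥0∞} (hm : Monotone ψ)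
    (hc : ConvexOn ℝ≥0 univ ψ) (h0 : ψ 0 = 0) (hl : IsLeftContinuous ψ) (u : ℝ≥0) :
    ψ u = ∫⁻ t in Ioo 0 (u : ℝ), extendedRightDeriv ψ t := by
  rcases eq_or_ne u 0 with rfl | hu0
  · simp [h0]
  -- If `ψ` is finite to the left of `u`, exhaust `(0, u)` from inside and use left continuity.
  -- Otherwise `ψ`, and hence the extended derivative, is infinite on an interval `(w, u)`, and both
  -- sides are `∞`.
  by_cases hfin : ∀ w < u, ψ w ≠ ⊤
  · obtain ⟨w, hw, hwu, hwt⟩ := exists_seq_strictMono_tendsto' (pos_iff_ne_zero.2 hu0)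
    have hU : Ioo 0 (u : ℝ) = ⋃ n, Ioo 0 (w n : ℝ) := by
      ext t
      simp only [mem_iUnion, mem_Ioo]
      constructor
      · rintro ⟨h1, h2⟩
        have : Tendsto (fun n => (w n : ℝ)) atTop (𝓝 (u : ℝ)) := NNReal.tendsto_coe.2 hwt
        obtain ⟨n, hn⟩ := (this.eventually (lt_mem_nhds h2)).exists
        exact ⟨n, h1, hn⟩
      · rintro ⟨n, h1, h2⟩
        exact ⟨h1, h2.trans (by exact_mod_cast (hwu n).2)⟩
    have hmw : Monotone fun n => Ioo 0 (w n : ℝ) := fun m n hmn =>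
      Ioo_subset_Ioo_right (by exact_mod_cast hw.monotone hmn)
    rw [hU, setLIntegral_iUnion_of_directed _ hmw.directed_le]
    have h1 : Tendsto (fun n => ψ (w n)) atTop (𝓝 (ψ u)) :=
      (hl u).tendsto.comp (tendsto_nhdsWithin_iff.2
        ⟨hwt, Eventually.of_forall fun n => (hwu n).2⟩)
    have h2 := tendsto_atTop_iSup (hm.comp hw.monotone)
    rw [tendsto_nhds_unique h1 h2]
    refine iSup_congr fun n => ?_
    exact eq_lintegral_extendedRightDeriv_of_lt hm hc h0 (hw (Nat.lt_succ_self n))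
      (hfin _ (hwu _).2)
  · push Not at hfin
    obtain ⟨w, hwu, hw⟩ := hfin
    have hwu' : (w : ℝ) < u := by exact_mod_cast hwu
    have htop : ψ u = ⊤ := top_le_iff.1 (hw ▸ hm hwu.le)
    rw [htop, eq_comm, eq_top_iff]
    calc (⊤ : ℝ≥0∞) = ∫⁻ t in Ioo (w : ℝ) u, ⊤ := by
          rw [setLIntegral_const, Real.volume_Ioo, ENNReal.top_mul (by simpa using hwu)]
      _ = ∫⁻ t in Ioo (w : ℝ) u, extendedRightDeriv ψ t := by
          refine setLIntegral_congr_fun measurableSet_Ioo fun t ht => ?_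
          rw [extendedRightDeriv, if_neg]
          rintro ⟨v, hv, hv'⟩
          refine hv' (top_le_iff.1 (hw ▸ hm ?_))
          exact_mod_cast (ht.1.trans hv).le
      _ ≤ _ := lintegral_mono_set (Ioo_subset_Ioo_left w.coe_nonneg)

/-- A left-continuous convex function is a mixture of the functions `u ↦ (u - s)₊`. -/
theorem exists_eq_lintegral_sub {ψ : ℝ≥0 → ℝ≥0∞} (hm : Monotone ψ)
    (hc : ConvexOn ℝ≥0 univ ψ) (h0 : ψ 0 = 0) (hl : IsLeftContinuous ψ) :
    ∃ s : ℝ → ℝ≥0∞, Measurable s ∧ ∀ u : ℝ≥0, ψ u = ∫⁻ r in Ioi (0 : ℝ), ((u : ℝ≥0∞) - s r) := by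
  set D := extendedRightDeriv ψ with hD
  have hDm : Monotone D := monotone_extendedRightDeriv hm hc
  -- Generalized inverse of `D`: as `D` is monotone, `{D > r}` is a half-line starting at `s r`, so
  -- it meets `(0, u)` in length `(u - s r)₊`. The layer-cake formula for `D` and Tonelli then give
  -- the mixture.
  set s : ℝ → ℝ≥0∞ := fun r => ⨅ (t : ℝ≥0) (_ : ENNReal.ofReal r < D t), (t : ℝ≥0∞) with hs
  have hsm : Monotone s := by
    intro r r' hr
    refine le_iInf₂ fun t ht => iInf₂_le t ?_
    exact (ENNReal.ofReal_le_ofReal hr).trans_lt ht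
  refine ⟨s, hsm.measurable, fun u => ?_⟩
  have layer : ∀ a : ℝ≥0∞, a = ∫⁻ r in Ioi (0 : ℝ), {r : ℝ | ENNReal.ofReal r < a}.indicator 1 r := by
    intro a
    have hms : MeasurableSet {r : ℝ | ENNReal.ofReal r < a} :=
      measurableSet_lt ENNReal.measurable_ofReal measurable_const
    rw [lintegral_indicator_one hms, Measure.restrict_apply hms]
    induction a with
    | top => simp
    | coe a =>
      have : {r : ℝ | ENNReal.ofReal r < a} ∩ Ioi 0 = Ioo 0 (a : ℝ) := by
        ext r
        simp only [mem_inter_iff, mem_ofPred_eq, mem_Ioi, mem_Ioo]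
        constructor
        · rintro ⟨h1, h2⟩
          refine ⟨h2, ?_⟩
          rwa [ENNReal.ofReal_lt_coe_iff h2.le] at h1
        · rintro ⟨h1, h2⟩
          refine ⟨?_, h1⟩
          rwa [ENNReal.ofReal_lt_coe_iff h1.le]
      rw [this]; simp
  have hmeas : MeasurableSet {q : ℝ × ℝ | ENNReal.ofReal q.2 < D q.1} :=
    measurableSet_lt (ENNReal.measurable_ofReal.comp measurable_snd)
      (hDm.measurable.comp measurable_fst)
  rw [eq_lintegral_extendedRightDeriv hm hc h0 hl u]
  calc ∫⁻ t in Ioo 0 (u : ℝ), D t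
      = ∫⁻ t in Ioo 0 (u : ℝ), ∫⁻ r in Ioi (0 : ℝ),
          {q : ℝ × ℝ | ENNReal.ofReal q.2 < D q.1}.indicator 1 (t, r) := by
        refine lintegral_congr fun t => ?_
        conv_lhs => rw [layer (D t)]
        rfl
    _ = ∫⁻ r in Ioi (0 : ℝ), ∫⁻ t in Ioo 0 (u : ℝ),
          {q : ℝ × ℝ | ENNReal.ofReal q.2 < D q.1}.indicator 1 (t, r) := by
        refine lintegral_lintegral_swap ?_
        exact (measurable_one.indicator hmeas).aemeasurable
    _ = _ := by
        refine lintegral_congr fun r => ?_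
        have hAm : MeasurableSet {t : ℝ | ENNReal.ofReal r < D t} :=
          measurableSet_lt measurable_const hDm.measurable
        have e : (fun t => {q : ℝ × ℝ | ENNReal.ofReal q.2 < D q.1}.indicator (1 : ℝ × ℝ → ℝ≥0∞)
            (t, r)) = {t : ℝ | ENNReal.ofReal r < D t}.indicator 1 := rfl
        rw [e, lintegral_indicator_one hAm, Measure.restrict_apply hAm]
        have lower : ∀ t : ℝ, 0 < t → ENNReal.ofReal r < D t → s r ≤ ENNReal.ofReal t := by
          intro t ht h
          refine iInf₂_le (t.toNNReal) ?_
          rwa [Real.coe_toNNReal _ ht.le]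
        have upper : ∀ t : ℝ, 0 < t → s r < ENNReal.ofReal t → ENNReal.ofReal r < D t := by
          intro t ht h
          simp only [hs, iInf_lt_iff] at h
          obtain ⟨t', h1, h2⟩ := h
          refine h1.trans_le (hDm ?_)
          have := (ENNReal.lt_ofReal_iff_toReal_lt ENNReal.coe_ne_top).1 h2
          simpa using this.le
        rcases eq_or_ne (s r) ⊤ with htop | hne
        · have : {t : ℝ | ENNReal.ofReal r < D t} ∩ Ioo 0 (u : ℝ) = ∅ := by
            ext t
            simp only [mem_inter_iff, mem_ofPred_eq, mem_Ioo, mem_empty_iff_false, iff_false]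
            rintro ⟨h1, h2, -⟩
            have := lower t h2 h1
            rw [htop, top_le_iff] at this
            exact ENNReal.ofReal_ne_top this
          simp [this, htop]
        · lift s r to ℝ≥0 using hne with c
          have hvol : ((u : ℝ≥0∞) - c) = ENNReal.ofReal (u - c) := by
            rw [ENNReal.ofReal_sub _ c.coe_nonneg]; simp
          rw [hvol]
          refine le_antisymm ?_ ?_
          · rw [← Real.volume_Icc]
            refine measure_mono fun t ht => ⟨?_, ht.2.2.le⟩
            have := lower t ht.2.1 ht.1
            exact Real.le_toNNReal_iff_coe_le ht.2.1.le |>.1 (ENNReal.coe_le_coe.1 this)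
          · rw [← Real.volume_Ioo]
            refine measure_mono fun t ht => ?_
            have h0t : 0 < t := lt_of_le_of_lt c.coe_nonneg ht.1
            refine ⟨upper t h0t ?_, h0t, ht.2⟩
            exact (ENNReal.lt_ofReal_iff_toReal_lt ENNReal.coe_ne_top).2 ht.1

/-- Domination of the integrals of all truncations `(f - s)₊` passes to the integrals of all
left-continuous convex functions vanishing at `0`. -/
theorem lintegral_convex_comp_le {Ω : Type*} [MeasurableSpace Ω] {μ : Measure Ω} [SFinite μ]
    {ψ : ℝ≥0 → ℝ≥0∞} (hm : Monotone ψ) (hc : ConvexOn ℝ≥0 univ ψ) (h0 : ψ 0 = 0)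
    (hl : IsLeftContinuous ψ) {f g : Ω → ℝ≥0} (hf : Measurable f) (hg : Measurable g)
    (h : ∀ s : ℝ≥0, ∫⁻ x, ((f x : ℝ≥0∞) - s) ∂μ ≤ ∫⁻ x, ((g x : ℝ≥0∞) - s) ∂μ) :
    ∫⁻ x, ψ (f x) ∂μ ≤ ∫⁻ x, ψ (g x) ∂μ := by
  obtain ⟨s, hs, hψ⟩ := exists_eq_lintegral_sub hm hc h0 hl
  have key : ∀ {k : Ω → ℝ≥0}, Measurable k → ∫⁻ x, ψ (k x) ∂μ =
      ∫⁻ r in Ioi (0 : ℝ), ∫⁻ x, ((k x : ℝ≥0∞) - s r) ∂μ := by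
    intro k hk
    simp_rw [hψ]
    refine lintegral_lintegral_swap (Measurable.aemeasurable ?_)
    exact (hk.coe_nnreal_ennreal.comp measurable_fst).sub (hs.comp measurable_snd)
  rw [key hf, key hg]
  refine lintegral_mono fun r => ?_
  -- The hypothesis covers finite levels only; at level `∞` both truncations vanish.
  rcases eq_or_ne (s r) ⊤ with htop | hne
  · simp [htop]
  · have := h (s r).toNNReal
    rwa [ENNReal.coe_toNNReal hne] at this

/-! ### Radial truncation -/

section

variable {Ω : Type*} [MeasurableSpace Ω] {𝕜 : Type*} [RCLike 𝕜] {μ : Measure Ω}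

/-- The radial truncation of a scalar at the level `l`. -/
noncomputable def radialTrunc (l : ℝ≥0) (z : 𝕜) : 𝕜 := ((l / max l ‖z‖₊ : ℝ≥0) : ℝ) • z

theorem nnnorm_radialTrunc_le (l : ℝ≥0) (z : 𝕜) : ‖radialTrunc l z‖₊ ≤ l := by
  rw [radialTrunc, nnnorm_smul, NNReal.nnnorm_eq]
  rcases eq_or_ne l 0 with rfl | hl
  · simp
  have hpos : 0 < max l ‖z‖₊ := lt_max_of_lt_left (pos_iff_ne_zero.2 hl)
  rw [div_mul_eq_mul_div, div_le_iff₀ hpos]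
  gcongr
  exact le_max_right _ _

theorem nnnorm_sub_radialTrunc_le (l : ℝ≥0) (z : 𝕜) : ‖z - radialTrunc l z‖₊ ≤ ‖z‖₊ - l := by
  rcases eq_or_ne (max l ‖z‖₊) 0 with h0 | h0
  · have hz : z = 0 := by
      rw [← nnnorm_eq_zero, ← nonpos_iff_eq_zero, ← h0]; exact le_max_right _ _
    simp [hz, radialTrunc]
  have hpos : 0 < max l ‖z‖₊ := pos_iff_ne_zero.2 h0
  set c : ℝ≥0 := l / max l ‖z‖₊ with hc
  have hc1 : c ≤ 1 := by
    rw [hc, div_le_one hpos]; exact le_max_left _ _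
  have e : z - radialTrunc l z = ((1 - c : ℝ≥0) : ℝ) • z := by
    rw [NNReal.coe_sub hc1, sub_smul, radialTrunc, ← hc, NNReal.coe_one, one_smul]
  rw [e, nnnorm_smul, NNReal.nnnorm_eq, tsub_mul, one_mul]
  rcases le_total l ‖z‖₊ with h | h
  · have : c * ‖z‖₊ = l := by
      rw [hc, max_eq_right h, div_mul_cancel₀]
      rwa [max_eq_right h] at h0
    rw [this]
  · have : c = 1 := by
      rw [hc, max_eq_left h, div_self]
      rwa [max_eq_left h] at h0
    simp [this]

theorem measurable_radialTrunc (l : ℝ≥0) : Measurable (radialTrunc l : 𝕜 → 𝕜) := by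
  unfold radialTrunc
  fun_prop

/-- The radial truncation of a class of measurable functions. -/
noncomputable def MeasureTheory.AEEqFun.radialTrunc (l : ℝ≥0) (x : Ω →ₘ[μ] 𝕜) : Ω →ₘ[μ] 𝕜 :=
  AEEqFun.mk (fun t => _root_.radialTrunc l (x t))
    ((measurable_radialTrunc l).comp x.measurable).aestronglyMeasurable

theorem MeasureTheory.AEEqFun.coeFn_radialTrunc (l : ℝ≥0) (x : Ω →ₘ[μ] 𝕜) :
    x.radialTrunc l =ᵐ[μ] fun t => _root_.radialTrunc l (x t) :=
  AEEqFun.coeFn_mk _ _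

theorem eLpNorm_top_radialTrunc_le (l : ℝ≥0) (x : Ω →ₘ[μ] 𝕜) :
    eLpNorm (x.radialTrunc l) ⊤ μ ≤ l := by
  rw [eLpNorm_exponent_top]
  refine eLpNormEssSup_le_of_ae_nnnorm_bound ?_
  filter_upwards [x.coeFn_radialTrunc l] with t ht
  rw [ht]
  exact nnnorm_radialTrunc_le l _

theorem ae_nnnorm_sub_radialTrunc_le (l : ℝ≥0) (x : Ω →ₘ[μ] 𝕜) :
    ∀ᵐ t ∂μ, ‖(x - x.radialTrunc l) t‖₊ ≤ ‖x t‖₊ - l := by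
  filter_upwards [x.coeFn_radialTrunc l, AEEqFun.coeFn_sub x (x.radialTrunc l)] with t ht h
  rw [h, Pi.sub_apply, ht]
  exact nnnorm_sub_radialTrunc_le l _

theorem radialTrunc_mem_lebesgue_top (l : ℝ≥0) (x : Ω →ₘ[μ] 𝕜) :
    x.radialTrunc l ∈ (FnSpace.lebesgue 𝕜 μ ⊤).carrier :=
  Lp.mem_Lp_iff_eLpNorm_lt_top.2 ((eLpNorm_top_radialTrunc_le l x).trans_lt ENNReal.coe_lt_top)

theorem eLpNorm_rpow_eq_lintegral {p : ℝ≥0} (hp : 1 ≤ p) (x : Ω →ₘ[μ] 𝕜) :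
    eLpNorm x p μ ^ (p : ℝ) = ∫⁻ t, ((‖x t‖₊ ^ (p : ℝ) : ℝ≥0) : ℝ≥0∞) ∂μ := by
  have hp0 : p ≠ 0 := (zero_lt_one.trans_le hp).ne'
  rw [eLpNorm_nnreal_pow_eq_lintegral hp0]
  refine lintegral_congr fun t => ?_
  rw [ENNReal.coe_rpow_of_nonneg _ p.coe_nonneg]
  rfl

/-! ### The truncation estimate for admissible operators -/

namespace FnSpace

/-- A subadditive operator which is bounded on `L^q` vanishes at `0`, hence the bound for the
operator norm holds for every element of `L^q`. -/
theorem eLpNorm_apply_le {X₀ X₁ : FnSpace 𝕜 μ} {T : sum X₀ X₁ → sum X₀ X₁}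
    (hT : IsSubadditive T) {q : ℝ≥0∞} (hq : 1 ≤ q)
    (hsub : (lebesgue 𝕜 μ q).carrier ⊆ sum X₀ X₁) (hmap : MapsInto T (lebesgue 𝕜 μ q))
    {K : ℝ≥0} (hK : opNrm T (lebesgue 𝕜 μ q) ≤ K) (x : sum X₀ X₁)
    (hx : x.1 ∈ (lebesgue 𝕜 μ q).carrier) :
    eLpNorm (T x).1 q μ ≤ K * eLpNorm x.1 q μ := by
  have hq0 : q ≠ 0 := (zero_lt_one.trans_le hq).ne'
  have nz : ∀ x : sum X₀ X₁, x.1 ∈ (lebesgue 𝕜 μ q).carrier → x.1 ≠ 0 →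
      eLpNorm (T x).1 q μ ≤ K * eLpNorm x.1 q μ := by
    intro x hx hx0
    have h1 : eLpNorm (T x).1 q μ / eLpNorm x.1 q μ ≤ K :=
      by
      refine le_trans ?_ hK
      exact le_iSup₂_of_le (f := fun (x : sum X₀ X₁) (_ : x.1 ∈ (lebesgue 𝕜 μ q).carrier) =>
        ⨆ _ : x.1 ≠ 0, (lebesgue 𝕜 μ q).nrm (T x).1 / (lebesgue 𝕜 μ q).nrm x.1) x hx
        (le_iSup (fun _ : x.1 ≠ 0 => eLpNorm (T x).1 q μ / eLpNorm x.1 q μ) hx0)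
    have h2 : eLpNorm x.1 q μ ≠ ⊤ := (Lp.mem_Lp_iff_eLpNorm_lt_top.1 hx).ne
    have h3 : eLpNorm x.1 q μ ≠ 0 := by
      rw [Ne, eLpNorm_eq_zero_iff x.1.aestronglyMeasurable hq0]
      exact fun h => hx0 (AEEqFun.ext (h.trans AEEqFun.coeFn_zero.symm))
    exact (ENNReal.div_le_iff h3 h2).1 h1
  by_cases hx0 : x.1 = 0
  swap
  · exact nz x hx hx0
  have hTx := hmap x hx
  suffices h : eLpNorm (T x).1 q μ = 0 by rw [h]; exact zero_le
  by_cases hw0 : (T x).1 = 0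
  · rw [hw0, eLpNorm_congr_ae AEEqFun.coeFn_zero, eLpNorm_zero]
  have hNtop : eLpNorm (T x).1 q μ ≠ ⊤ := (Lp.mem_Lp_iff_eLpNorm_lt_top.1 hTx).ne
  -- The supremum in `opNrm` omits `0`, so `T 0` is controlled through `0 = ε T0 + (-ε) T0`.
  -- Subadditivity gives `‖T0‖ ≤ 2 K ε ‖T0‖`, and this `ε` makes `2 K ε ≤ 1/2`, forcing `‖T0‖ = 0`.
  set ε : ℝ := ((4 * K + 4 : ℝ≥0) : ℝ)⁻¹ with hε
  have hεpos : ε ≠ 0 := by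
    rw [hε]; positivity
  have small : ∀ c : ℝ, c ≠ 0 → c • (T x).1 ∈ (lebesgue 𝕜 μ q).carrier ∧ c • (T x).1 ≠ 0 ∧
      eLpNorm (c • (T x).1 : Ω →ₘ[μ] 𝕜) q μ = ‖c‖ₑ * eLpNorm (T x).1 q μ := by
    intro c hc
    have e : eLpNorm (c • (T x).1 : Ω →ₘ[μ] 𝕜) q μ = ‖c‖ₑ * eLpNorm (T x).1 q μ := by
      rw [eLpNorm_congr_ae (AEEqFun.coeFn_smul c (T x).1), eLpNorm_const_smul]
    refine ⟨?_, smul_ne_zero hc hw0, e⟩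
    refine Lp.mem_Lp_iff_eLpNorm_lt_top.2 ?_
    rw [e]
    exact ENNReal.mul_lt_top enorm_lt_top hNtop.lt_top
  obtain ⟨m1, n1, e1⟩ := small ε hεpos
  obtain ⟨m2, n2, e2⟩ := small (-ε) (neg_ne_zero.2 hεpos)
  set y : sum X₀ X₁ := ⟨ε • (T x).1, hsub m1⟩
  set z : sum X₀ X₁ := ⟨(-ε) • (T x).1, hsub m2⟩
  have hadd : x.1 = y.1 + z.1 := by
    have h := add_smul ε (-ε) (T x).1
    rw [add_neg_cancel, zero_smul] at h
    exact hx0.trans h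
  have h1 : eLpNorm (T x).1 q μ ≤ eLpNorm (T y).1 q μ + eLpNorm (T z).1 q μ := by
    calc eLpNorm (T x).1 q μ
        ≤ eLpNorm ((fun t => ‖(T y).1 t‖) + (fun t => ‖(T z).1 t‖)) q μ := by
          refine eLpNorm_mono_ae ?_
          filter_upwards [hT y z x hadd] with t ht
          refine ht.trans (le_abs_self _)
      _ ≤ eLpNorm (fun t => ‖(T y).1 t‖) q μ + eLpNorm (fun t => ‖(T z).1 t‖) q μ :=
          eLpNorm_add_le (T y).1.aestronglyMeasurable.norm (T z).1.aestronglyMeasurable.norm hq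
      _ = _ := by rw [eLpNorm_norm, eLpNorm_norm]
  have h2 := h1.trans (add_le_add (nz y m1 n1) (nz z m2 n2))
  have hεe : ‖ε‖ₑ = (((4 * K + 4)⁻¹ : ℝ≥0) : ℝ≥0∞) := by
    rw [hε, ← NNReal.coe_inv, enorm_eq_nnnorm, NNReal.nnnorm_eq]
  rw [show eLpNorm (y.1) q μ = _ from e1, show eLpNorm (z.1) q μ = _ from e2, enorm_neg, hεe] at h2
  lift eLpNorm (T x).1 q μ to ℝ≥0 using hNtop with N
  norm_cast at h2 ⊢
  by_contra hN
  have hNpos : 0 < N := pos_iff_ne_zero.2 hN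
  have h3 : K * (4 * K + 4)⁻¹ ≤ 1 / 4 := by
    rw [← div_eq_mul_inv, div_le_div_iff₀ (by positivity) (by positivity), one_mul, mul_comm]
    exact le_self_add
  have h4 : N ≤ 1 / 4 * N + 1 / 4 * N := by
    refine h2.trans ?_
    rw [← mul_assoc]
    gcongr
  have h5 : (N : ℝ) ≤ 1 / 4 * N + 1 / 4 * N := by exact_mod_cast h4
  have h6 : (0 : ℝ) < N := by exact_mod_cast hNpos
  linarith

end FnSpace

theorem rpow_two_one_sub_pos (p : ℝ) : (0 : ℝ≥0) < 2 ^ (1 - 1 / p) :=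
  NNReal.rpow_pos two_pos

/-- The scalar inequality behind the truncation argument. -/
theorem rpow_div_le {p : ℝ} (hp : 1 ≤ p) {K a b l : ℝ≥0} (hK : 0 < K) {w : ℝ≥0}
    (hw : w ≤ a + b) (hb : b ≤ K * l) :
    (w / (2 ^ (1 - 1 / p) * K)) ^ p ≤ (a / K) ^ p + l ^ p := by
  have hp0 : p ≠ 0 := (zero_lt_one.trans_le hp).ne'
  have h1 : w / K ≤ a / K + l := by
    rw [div_le_iff₀ hK, add_mul, div_mul_cancel₀ _ hK.ne', mul_comm l]
    exact hw.trans (by gcongr)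
  -- The interpolation constant originates here: its `p`-th power is the factor in `(a + b)^p ≤
  -- 2^(p-1) (a^p + b^p)`.
  have h2 : ((2 : ℝ≥0) ^ (1 - 1 / p)) ^ p = 2 ^ (p - 1) := by
    rw [← NNReal.rpow_mul]; congr 1; field_simp
  have h3 : (0 : ℝ≥0) < 2 ^ (p - 1) := NNReal.rpow_pos two_pos
  rw [mul_comm, ← div_div, NNReal.div_rpow, h2, div_le_iff₀ h3, mul_comm]
  exact (NNReal.rpow_le_rpow h1 (zero_le_one.trans hp)).trans
    (NNReal.rpow_add_le_mul_rpow_add_rpow _ _ hp)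

theorem tsub_rpow_le {p : ℝ} (hp : 1 ≤ p) (a l : ℝ≥0) : (a - l) ^ p ≤ a ^ p - l ^ p := by
  rcases le_total a l with h | h
  · rw [tsub_eq_zero_of_le h, NNReal.zero_rpow (zero_lt_one.trans_le hp).ne']
    exact zero_le
  · refine le_tsub_of_add_le_right ?_
    conv_rhs => rw [← tsub_add_cancel_of_le h]
    exact NNReal.add_rpow_le_rpow_add _ _ hp

namespace FnSpace

variable {p : ℝ≥0} {T : sum (lebesgue 𝕜 μ p) (lebesgue 𝕜 μ ⊤) →
    sum (lebesgue 𝕜 μ p) (lebesgue 𝕜 μ ⊤)}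

theorem lebesgue_subset_sum_left (X : FnSpace 𝕜 μ) (hX : 0 ∈ X.carrier) (q : ℝ≥0∞) :
    (lebesgue 𝕜 μ q).carrier ⊆ sum (lebesgue 𝕜 μ q) X :=
  fun x hx => ⟨x, hx, 0, hX, add_zero x⟩

theorem lebesgue_subset_sum_right (X : FnSpace 𝕜 μ) (hX : 0 ∈ X.carrier) (q : ℝ≥0∞) :
    (lebesgue 𝕜 μ q).carrier ⊆ sum X (lebesgue 𝕜 μ q) :=
  fun x hx => ⟨0, hX, x, hx, zero_add x⟩

theorem zero_mem_lebesgue (q : ℝ≥0∞) : 0 ∈ (lebesgue 𝕜 μ q).carrier :=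
  (Lp 𝕜 q μ).zero_mem

/-- The core of the argument: the part of `x` below the level only costs `K l` pointwise, which
subtracting `s` absorbs, while the part above it is handled by the `L^p` bound. -/
theorem lintegral_tsub_apply_le (hp : 1 ≤ p) (hT : IsAdmissible T) {K : ℝ≥0} (hK : 0 < K)
    (hM : maxNrm T ≤ K) (x : sum (lebesgue 𝕜 μ p) (lebesgue 𝕜 μ ⊤)) (s : ℝ≥0) :
    ∫⁻ t, ((((‖(T x).1 t‖₊ / (2 ^ (1 - 1 / (p : ℝ)) * K)) ^ (p : ℝ) : ℝ≥0) : ℝ≥0∞) - s) ∂μ ≤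
      ∫⁻ t, (((‖x.1 t‖₊ ^ (p : ℝ) : ℝ≥0) : ℝ≥0∞) - s) ∂μ := by
  have hp' : (1 : ℝ) ≤ p := by exact_mod_cast hp
  have hp0 : (p : ℝ) ≠ 0 := (zero_lt_one.trans_le hp').ne'
  have hp1 : (1 : ℝ≥0∞) ≤ p := by exact_mod_cast hp
  -- The level for `|x|` that corresponds to the level `s` for `|x|^p`.
  set l : ℝ≥0 := s ^ (1 / (p : ℝ)) with hl
  have hls : l ^ (p : ℝ) = s := by
    rw [hl, ← NNReal.rpow_mul, one_div_mul_cancel hp0, NNReal.rpow_one]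
  set x₁ := x.1.radialTrunc l with hx₁
  set x₀ := x.1 - x₁ with hx₀
  have hm₁ : x₁ ∈ (lebesgue 𝕜 μ ⊤).carrier := radialTrunc_mem_lebesgue_top l x.1
  have hR : eLpNorm x₀ p μ ^ (p : ℝ) ≤ ∫⁻ t, (((‖x.1 t‖₊ ^ (p : ℝ) : ℝ≥0) : ℝ≥0∞) - s) ∂μ := by
    rw [eLpNorm_rpow_eq_lintegral hp]
    refine lintegral_mono_ae ?_
    filter_upwards [ae_nnnorm_sub_radialTrunc_le l x.1] with t ht
    rw [← ENNReal.coe_sub, ENNReal.coe_le_coe, ← hls]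
    exact (NNReal.rpow_le_rpow ht p.coe_nonneg).trans (tsub_rpow_le hp' _ _)
  -- If the upper part is not in `L^p`, then `T` cannot be applied to it separately, but `hR` shows
  -- that the right-hand side is infinite.
  by_cases hfin : eLpNorm x₀ p μ = ⊤
  · rw [hfin, ENNReal.top_rpow_of_pos (zero_lt_one.trans_le hp'), top_le_iff] at hR
    rw [hR]; exact le_top
  have hm₀ : x₀ ∈ (lebesgue 𝕜 μ p).carrier := Lp.mem_Lp_iff_eLpNorm_lt_top.2 (Ne.lt_top hfin)
  have hs₀ := lebesgue_subset_sum_left (lebesgue 𝕜 μ ⊤) (zero_mem_lebesgue ⊤) p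
  have hs₁ := lebesgue_subset_sum_right (lebesgue 𝕜 μ p) (zero_mem_lebesgue (p : ℝ≥0∞)) ⊤
  set y₀ : sum (lebesgue 𝕜 μ p) (lebesgue 𝕜 μ ⊤) := ⟨x₀, hs₀ hm₀⟩
  set y₁ : sum (lebesgue 𝕜 μ p) (lebesgue 𝕜 μ ⊤) := ⟨x₁, hs₁ hm₁⟩
  have hT₀ : eLpNorm (T y₀).1 p μ ≤ K * eLpNorm x₀ p μ :=
    eLpNorm_apply_le hT.subadditive hp1 hs₀ hT.mapsInto₀ ((le_max_left _ _).trans hM) y₀ hm₀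
  have hT₁ : eLpNorm (T y₁).1 ⊤ μ ≤ K * eLpNorm x₁ ⊤ μ :=
    eLpNorm_apply_le hT.subadditive le_top hs₁ hT.mapsInto₁ ((le_max_right _ _).trans hM) y₁ hm₁
  have hT₁' : ∀ᵐ t ∂μ, ‖(T y₁).1 t‖₊ ≤ K * l := by
    have h1 : eLpNorm (T y₁).1 ⊤ μ ≤ ((K * l : ℝ≥0) : ℝ≥0∞) := by
      refine hT₁.trans ?_
      rw [ENNReal.coe_mul]
      gcongr
      exact eLpNorm_top_radialTrunc_le l x.1
    rw [eLpNorm_exponent_top] at h1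
    filter_upwards [enorm_ae_le_eLpNormEssSup (T y₁).1 μ] with t ht
    exact ENNReal.coe_le_coe.1 (ht.trans h1)
  have hadd : x.1 = y₀.1 + y₁.1 := by simp [y₀, y₁, hx₀]
  refine le_trans ?_ hR
  have hKe : (K : ℝ≥0∞) ≠ 0 := by simpa using hK.ne'
  calc ∫⁻ t, ((((‖(T x).1 t‖₊ / (2 ^ (1 - 1 / (p : ℝ)) * K)) ^ (p : ℝ) : ℝ≥0) : ℝ≥0∞) - s) ∂μ
      ≤ ∫⁻ t, (((‖(T y₀).1 t‖₊ / K) ^ (p : ℝ) : ℝ≥0) : ℝ≥0∞) ∂μ := by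
        refine lintegral_mono_ae ?_
        filter_upwards [hT₁', hT.subadditive y₀ y₁ x hadd] with t h1 h2
        rw [← ENNReal.coe_sub, ENNReal.coe_le_coe, ← hls, tsub_le_iff_right]
        exact rpow_div_le hp' hK h2 h1
    _ = (((K⁻¹ : ℝ≥0) : ℝ≥0∞)) ^ (p : ℝ) * eLpNorm (T y₀).1 p μ ^ (p : ℝ) := by
        rw [eLpNorm_rpow_eq_lintegral hp, ← ENNReal.coe_rpow_of_nonneg _ p.coe_nonneg,
          ← lintegral_const_mul']
        · refine lintegral_congr fun t => ?_
          rw [← ENNReal.coe_mul, ← NNReal.mul_rpow, div_eq_inv_mul]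
        · exact ENNReal.coe_ne_top
    _ ≤ (((K⁻¹ : ℝ≥0) : ℝ≥0∞)) ^ (p : ℝ) * (K * eLpNorm x₀ p μ) ^ (p : ℝ) := by
        gcongr
    _ = eLpNorm x₀ p μ ^ (p : ℝ) := by
        rw [← ENNReal.mul_rpow_of_nonneg _ _ p.coe_nonneg, ← mul_assoc, ENNReal.coe_inv hK.ne',
          ENNReal.inv_mul_cancel hKe ENNReal.coe_ne_top, one_mul]

end FnSpace

theorem modular_smul (φ : ℝ≥0 → ℝ≥0∞) (c : ℝ) (x : Ω →ₘ[μ] 𝕜) :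
    modular φ (c • x) = ∫⁻ t, φ (‖c‖₊ * ‖x t‖₊) ∂μ := by
  refine lintegral_congr_ae ?_
  filter_upwards [AEEqFun.coeFn_smul c x] with t ht
  rw [ht, Pi.smul_apply, nnnorm_smul]

/-- The modular estimate, at every scale and for every bound `K` of the operator. -/
theorem modular_smul_apply_le [SFinite μ] {φ : ℝ≥0 → ℝ≥0∞} {p : ℝ≥0} (hp : 1 ≤ p) (hm : Monotone φ)
    (h0 : φ 0 = 0) (hl : IsLeftContinuous φ)
    (hc : ConvexOn ℝ≥0 univ (fun u : ℝ≥0 => φ (u ^ (1 / (p : ℝ)))))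
    {T : FnSpace.sum (FnSpace.lebesgue 𝕜 μ p) (FnSpace.lebesgue 𝕜 μ ⊤) →
      FnSpace.sum (FnSpace.lebesgue 𝕜 μ p) (FnSpace.lebesgue 𝕜 μ ⊤)}
    (hT : FnSpace.IsAdmissible T) {K : ℝ≥0} (hK : 0 < K) (hM : FnSpace.maxNrm T ≤ K) {c : ℝ}
    (hcpos : 0 < c) (x : FnSpace.sum (FnSpace.lebesgue 𝕜 μ p) (FnSpace.lebesgue 𝕜 μ ⊤)) :
    modular φ ((c * ((2 : ℝ) ^ (1 - 1 / (p : ℝ)) * K)⁻¹) • (T x).1) ≤ modular φ (c • x.1) := by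
  have hp' : (1 : ℝ) ≤ p := by exact_mod_cast hp
  have hp0 : (p : ℝ) ≠ 0 := (zero_lt_one.trans_le hp').ne'
  have hip : 0 < 1 / (p : ℝ) := by positivity
  lift c to ℝ≥0 using hcpos.le
  have hcpos' : 0 < c := by exact_mod_cast hcpos
  -- The scale `c` is built into `ψ`; since `c u^(1/p) = (c^p u)^(1/p)`, this is a dilation of `u ↦
  -- φ(u^(1/p))` and remains convex.
  set ψ : ℝ≥0 → ℝ≥0∞ := fun u => φ (c * u ^ (1 / (p : ℝ))) with hψ
  have hinv : ∀ a : ℝ≥0, (a ^ (p : ℝ)) ^ (1 / (p : ℝ)) = a := fun a => by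
    rw [← NNReal.rpow_mul, mul_one_div_cancel hp0, NNReal.rpow_one]
  have hψm : Monotone ψ := fun a b hab => hm (by gcongr)
  have hψ0 : ψ 0 = 0 := by
    simp only [hψ]
    rw [NNReal.zero_rpow hip.ne', mul_zero, h0]
  have hψc : ConvexOn ℝ≥0 univ ψ := by
    have e : ψ = fun u : ℝ≥0 => φ ((c ^ (p : ℝ) * u) ^ (1 / (p : ℝ))) := by
      ext u; rw [NNReal.mul_rpow, hinv]
    rw [e]
    refine ⟨convex_univ, fun a _ b _ α β hα hβ hαβ => ?_⟩
    have := hc.2 (mem_univ (c ^ (p : ℝ) * a)) (mem_univ (c ^ (p : ℝ) * b)) hα hβ hαβ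
    simp only [smul_eq_mul] at this ⊢
    convert this using 3
    ring
  have hψl : IsLeftContinuous ψ := by
    intro u
    refine ContinuousWithinAt.comp (t := Iio (c * u ^ (1 / (p : ℝ)))) (hl _) ?_ ?_
    · refine Continuous.continuousWithinAt ?_
      exact continuous_const.mul (NNReal.continuous_rpow_const hip.le)
    · intro v hv
      exact mul_lt_mul_of_pos_left (NNReal.rpow_lt_rpow hv hip) hcpos'
  have key := lintegral_convex_comp_le (μ := μ) hψm hψc hψ0 hψl
    (f := fun t => (‖(T x).1 t‖₊ / (2 ^ (1 - 1 / (p : ℝ)) * K)) ^ (p : ℝ))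
    (g := fun t => ‖x.1 t‖₊ ^ (p : ℝ))
    (((T x).1.measurable.nnnorm.div_const _).pow_const _)
    (x.1.measurable.nnnorm.pow_const _)
    (FnSpace.lintegral_tsub_apply_le hp hT hK hM x)
  rw [modular_smul, modular_smul]
  simp only [hψ, hinv] at key
  have e1 : ∀ a : ℝ≥0, ‖(c : ℝ) * ((2 : ℝ) ^ (1 - 1 / (p : ℝ)) * K)⁻¹‖₊ * a =
      c * (a / (2 ^ (1 - 1 / (p : ℝ)) * K)) := by
    intro a
    have e2 : (c : ℝ) * ((2 : ℝ) ^ (1 - 1 / (p : ℝ)) * K)⁻¹ =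
        ((c * (2 ^ (1 - 1 / (p : ℝ)) * K)⁻¹ : ℝ≥0) : ℝ) := by
      push_cast; rfl
    rw [e2, NNReal.nnnorm_eq, mul_assoc, div_eq_inv_mul a]
  simpa only [e1, NNReal.nnnorm_eq] using key

end

/-! ### Modulars and norms defined by weights -/

section

variable {Ω : Type*} [MeasurableSpace Ω] {𝕜 : Type*} [RCLike 𝕜] {μ : Measure Ω}
  {φ : ℝ≥0 → ℝ≥0∞}

theorem modular_coe_smul (φ : ℝ≥0 → ℝ≥0∞) (c : ℝ≥0) (x : Ω →ₘ[μ] 𝕜) :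
    modular φ ((c : ℝ) • x) = ∫⁻ t, φ (c * ‖x t‖₊) ∂μ := by
  rw [modular_smul, NNReal.nnnorm_eq]

theorem modular_coe_smul_smul (φ : ℝ≥0 → ℝ≥0∞) (c : ℝ≥0) (a : 𝕜) (x : Ω →ₘ[μ] 𝕜) :
    modular φ ((c : ℝ) • (a • x)) = modular φ (((c * ‖a‖₊ : ℝ≥0) : ℝ) • x) := by
  rw [modular_coe_smul, modular_coe_smul]
  refine lintegral_congr_ae ?_
  filter_upwards [AEEqFun.coeFn_smul a x] with t ht
  rw [ht, Pi.smul_apply, nnnorm_smul, mul_assoc]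

theorem modular_coe_smul_mono (hm : Monotone φ) {c d : ℝ≥0} (h : c ≤ d) (x : Ω →ₘ[μ] 𝕜) :
    modular φ ((c : ℝ) • x) ≤ modular φ ((d : ℝ) • x) := by
  rw [modular_coe_smul, modular_coe_smul]
  exact lintegral_mono fun t => hm (by gcongr)

theorem IsOrliczFunction.map_mul_le (hφ : IsOrliczFunction φ) {a : ℝ≥0} (ha : a ≤ 1) (u : ℝ≥0) :
    φ (a * u) ≤ a * φ u := by
  have h := hφ.convex.2 (mem_univ u) (mem_univ 0) (zero_le (a := a)) (zero_le (a := 1 - a))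
    (add_tsub_cancel_of_le ha)
  simpa [hφ.map_zero, ENNReal.smul_def] using h

/-- Convexity and `φ 0 = 0` force at least linear growth, `n φ(u) ≤ φ(n u)`. -/
theorem IsOrliczFunction.exists_le (hφ : IsOrliczFunction φ) (N : ℝ≥0) :
    ∃ v : ℝ≥0, 0 < v ∧ (N : ℝ≥0∞) ≤ φ v := by
  obtain ⟨u, hu, hφu⟩ := hφ.not_zero
  obtain ⟨n, hn⟩ := ENNReal.exists_nat_mul_gt hφu (b := (N : ℝ≥0∞)) ENNReal.coe_ne_top
  have hn0 : 0 < n := Nat.pos_of_ne_zero fun h => by simp [h] at hn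
  have hn' : (1 : ℝ≥0) ≤ n := by exact_mod_cast hn0
  have hnpos : (0 : ℝ≥0) < n := zero_lt_one.trans_le hn'
  refine ⟨n * u, mul_pos hnpos hu, hn.le.trans ?_⟩
  have h := hφ.map_mul_le (inv_le_one_of_one_le₀ hn') (n * u)
  rw [inv_mul_cancel_left₀ hnpos.ne', ENNReal.coe_inv hnpos.ne'] at h
  calc (n : ℝ≥0∞) * φ u ≤ n * ((n : ℝ≥0∞)⁻¹ * φ (n * u)) := by gcongr; exact_mod_cast h
    _ = φ (n * u) := by
      rw [← mul_assoc, ENNReal.mul_inv_cancel (by simpa using hn0.ne') (ENNReal.natCast_ne_top n),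
        one_mul]

theorem modular_mul_smul_le (hφ : IsOrliczFunction φ) {a : ℝ≥0} (ha : a ≤ 1) (c : ℝ≥0)
    (x : Ω →ₘ[μ] 𝕜) :
    modular φ (((a * c : ℝ≥0) : ℝ) • x) ≤ a * modular φ ((c : ℝ) • x) := by
  rw [modular_coe_smul, modular_coe_smul, ← lintegral_const_mul' _ _ ENNReal.coe_ne_top]
  refine lintegral_mono fun t => ?_
  rw [mul_assoc]
  exact hφ.map_mul_le ha _

theorem modular_convex_comb_le (hφ : IsOrliczFunction φ) {a b : ℝ≥0} (hab : a + b = 1)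
    {c d e : ℝ≥0} (hc : e = a * c) (hd : e = b * d) (x y : Ω →ₘ[μ] 𝕜) :
    modular φ ((e : ℝ) • (x + y)) ≤
      a * modular φ ((c : ℝ) • x) + b * modular φ ((d : ℝ) • y) := by
  rw [modular_coe_smul, modular_coe_smul, modular_coe_smul,
    ← lintegral_const_mul' _ _ ENNReal.coe_ne_top, ← lintegral_const_mul' _ _ ENNReal.coe_ne_top,
    ← lintegral_add_left]
  · refine lintegral_mono_ae ?_
    filter_upwards [AEEqFun.coeFn_add x y] with t ht
    have h1 : e * ‖(x + y) t‖₊ ≤ a • (c * ‖x t‖₊) + b • (d * ‖y t‖₊) := by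
      rw [ht, Pi.add_apply, smul_eq_mul, smul_eq_mul, ← mul_assoc, ← mul_assoc, ← hc, ← hd,
        ← mul_add]
      gcongr
      exact nnnorm_add_le _ _
    exact (hφ.mono h1).trans (hφ.convex.2 (mem_univ _) (mem_univ _) zero_le zero_le hab)
  · exact (hφ.mono.measurable.comp (x.measurable.nnnorm.const_mul c)).const_mul _

/-- The weights `W` for which `⨅ l > 0, l * W (I_φ (x / l))` is a norm equivalent to the
Luxemburg–Nakano norm. -/
structure IsNormWeight (W : ℝ≥0∞ → ℝ≥0∞) : Prop where
  map_zero : W 0 = 1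
  mono : Monotone W
  one_le : ∀ a, 1 ≤ W a
  self_le : ∀ a, a ≤ W a
  map_one : W 1 ≠ ⊤
  convex : ∀ (a b : ℝ≥0) (u v : ℝ≥0∞), a + b = 1 → W (a * u + b * v) ≤ a * W u + b * W v

/-- The norm of the Orlicz space associated with a weight. -/
noncomputable def weightedNorm (φ : ℝ≥0 → ℝ≥0∞) (W : ℝ≥0∞ → ℝ≥0∞) (x : Ω →ₘ[μ] 𝕜) : ℝ≥0∞ :=
  ⨅ (l : ℝ≥0) (_ : 0 < l), (l : ℝ≥0∞) * W (modular φ (((l⁻¹ : ℝ≥0) : ℝ) • x))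

/-- The weight of the Luxemburg–Nakano norm. -/
noncomputable def luxemburgWeight (a : ℝ≥0∞) : ℝ≥0∞ := if a ≤ 1 then 1 else ⊤

theorem isNormWeight_luxemburgWeight : IsNormWeight luxemburgWeight where
  map_zero := by simp [luxemburgWeight]
  mono a b hab := by
    unfold luxemburgWeight
    split_ifs with h1 h2 h2
    · rfl
    · exact le_top
    · exact absurd (hab.trans h2) h1
    · rfl
  one_le a := by
    unfold luxemburgWeight
    split_ifs <;> simp
  self_le a := by
    unfold luxemburgWeight
    split_ifs with h
    · exact h
    · exact le_top
  map_one := by simp [luxemburgWeight]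
  convex a b u v hab := by
    unfold luxemburgWeight
    have hab' : (a : ℝ≥0∞) + b = 1 := by exact_mod_cast hab
    by_cases hu : u ≤ 1
    · by_cases hv : v ≤ 1
      · have : (a : ℝ≥0∞) * u + b * v ≤ 1 := by
          calc (a : ℝ≥0∞) * u + b * v ≤ a * 1 + b * 1 := by gcongr
            _ = 1 := by simpa using hab'
        simp [this, hu, hv, hab']
      · rcases eq_or_ne b 0 with rfl | hb
        · have ha : a = 1 := by simpa using hab
          simp [ha, hu]
        · simp [hv, ENNReal.mul_top, hb]
    · rcases eq_or_ne a 0 with rfl | ha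
      · have hb : b = 1 := by simpa using hab
        simp [hb]
      · simp [hu, ENNReal.mul_top, ha]

theorem isNormWeight_one_add : IsNormWeight (fun a => 1 + a) where
  map_zero := by simp
  mono a b hab := by dsimp only; gcongr
  one_le a := le_self_add
  self_le a := le_add_self
  map_one := by simp
  convex a b u v hab := by
    have hab' : (a : ℝ≥0∞) + b = 1 := by exact_mod_cast hab
    refine le_of_eq ?_
    conv_lhs => rw [← hab']
    ring

theorem luxemburgNorm_eq_weightedNorm (φ : ℝ≥0 → ℝ≥0∞) (x : Ω →ₘ[μ] 𝕜) :
    luxemburgNorm φ x = weightedNorm φ luxemburgWeight x := by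
  refine le_antisymm (le_iInf₂ fun l hl => ?_) (le_iInf₂ fun l hl => le_iInf fun h => ?_)
  · unfold luxemburgWeight
    split_ifs with h
    · refine iInf₂_le_of_le (l : ℝ) (by exact_mod_cast hl) ?_
      rw [NNReal.coe_inv] at h
      refine iInf_le_of_le h ?_
      simp
    · rw [ENNReal.mul_top (by simpa using hl.ne')]
      exact le_top
  · lift l to ℝ≥0 using hl.le
    refine iInf₂_le_of_le l (by exact_mod_cast hl) ?_
    rw [NNReal.coe_inv, luxemburgWeight, if_pos h]
    simp

theorem orliczNorm_eq_weightedNorm (φ : ℝ≥0 → ℝ≥0∞) (x : Ω →ₘ[μ] 𝕜) :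
    orliczNorm φ x = weightedNorm φ (fun a => 1 + a) x := by
  refine le_antisymm (le_iInf₂ fun l hl => ?_) (le_iInf₂ fun l hl => ?_)
  · refine iInf₂_le_of_le ((l⁻¹ : ℝ≥0) : ℝ) (by exact_mod_cast inv_pos.2 hl) ?_
    rw [ENNReal.ofReal_coe_nnreal, ENNReal.coe_inv hl.ne', inv_inv]
  · lift l to ℝ≥0 using hl.le
    have hl' : 0 < l := by exact_mod_cast hl
    refine iInf₂_le_of_le l⁻¹ (inv_pos.2 hl') ?_
    rw [ENNReal.ofReal_coe_nnreal, ENNReal.coe_inv hl'.ne', inv_inv]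

variable {W : ℝ≥0∞ → ℝ≥0∞}

theorem weightedNorm_le (φ : ℝ≥0 → ℝ≥0∞) (W : ℝ≥0∞ → ℝ≥0∞) (x : Ω →ₘ[μ] 𝕜) {l : ℝ≥0}
    (hl : 0 < l) :
    weightedNorm φ W x ≤ l * W (modular φ (((l⁻¹ : ℝ≥0) : ℝ) • x)) :=
  iInf₂_le l hl

theorem luxemburgNorm_le (x : Ω →ₘ[μ] 𝕜) {l : ℝ≥0} (hl : 0 < l)
    (h : modular φ (((l⁻¹ : ℝ≥0) : ℝ) • x) ≤ 1) : luxemburgNorm φ x ≤ l := by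
  rw [NNReal.coe_inv] at h
  refine iInf₂_le_of_le (l : ℝ) (by exact_mod_cast hl) (iInf_le_of_le h ?_)
  simp

theorem modular_le_one_of_luxemburgNorm_lt (hm : Monotone φ) {x : Ω →ₘ[μ] 𝕜} {l : ℝ≥0}
    (h : luxemburgNorm φ x < l) : modular φ (((l⁻¹ : ℝ≥0) : ℝ) • x) ≤ 1 := by
  simp only [luxemburgNorm, iInf_lt_iff] at h
  obtain ⟨k, hk, h1, h2⟩ := h
  lift k to ℝ≥0 using hk.le
  have hk' : 0 < k := by exact_mod_cast hk
  rw [← NNReal.coe_inv] at h1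
  rw [ENNReal.ofReal_coe_nnreal, ENNReal.coe_lt_coe] at h2
  exact (modular_coe_smul_mono hm (inv_anti₀ hk' h2.le) x).trans h1

/-- If `w = W(I_φ(x/l))` is finite, then `w ≥ 1` and `I_φ(x/(l w)) ≤ I_φ(x/l) / w ≤ 1`, so `l w` is
admissible for the Luxemburg–Nakano norm. -/
theorem luxemburgNorm_le_weightedNorm (hφ : IsOrliczFunction φ) (hW : IsNormWeight W)
    (x : Ω →ₘ[μ] 𝕜) : luxemburgNorm φ x ≤ weightedNorm φ W x := by
  refine le_iInf₂ fun l hl => ?_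
  rcases eq_or_ne (W (modular φ (((l⁻¹ : ℝ≥0) : ℝ) • x))) ⊤ with htop | hne
  · rw [htop, ENNReal.mul_top (by simpa using hl.ne')]
    exact le_top
  have h1 := hW.one_le (modular φ (((l⁻¹ : ℝ≥0) : ℝ) • x))
  have h2 := hW.self_le (modular φ (((l⁻¹ : ℝ≥0) : ℝ) • x))
  lift W (modular φ (((l⁻¹ : ℝ≥0) : ℝ) • x)) to ℝ≥0 using hne with w
  have hw1 : 1 ≤ w := by exact_mod_cast h1
  have hw : 0 < w := zero_lt_one.trans_le hw1
  rw [← ENNReal.coe_mul]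
  refine luxemburgNorm_le x (mul_pos hl hw) ?_
  rw [mul_inv, mul_comm]
  refine (modular_mul_smul_le hφ (inv_le_one_of_one_le₀ hw1) _ x).trans ?_
  rw [ENNReal.coe_inv hw.ne']
  calc (w : ℝ≥0∞)⁻¹ * modular φ (((l⁻¹ : ℝ≥0) : ℝ) • x) ≤ (w : ℝ≥0∞)⁻¹ * w := by gcongr
    _ = 1 := ENNReal.inv_mul_cancel (by simpa using hw.ne') ENNReal.coe_ne_top

theorem weightedNorm_le_mul_luxemburgNorm (hW : IsNormWeight W) (x : Ω →ₘ[μ] 𝕜) :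
    weightedNorm φ W x ≤ W 1 * luxemburgNorm φ x := by
  have hW1 : W 1 ≠ 0 := (zero_lt_one.trans_le (hW.one_le 1)).ne'
  unfold luxemburgNorm
  rw [ENNReal.mul_iInf_of_ne hW1 hW.map_one]
  refine le_iInf fun l => ?_
  rw [ENNReal.mul_iInf_of_ne hW1 hW.map_one]
  refine le_iInf fun hl => ?_
  rw [ENNReal.mul_iInf_of_ne hW1 hW.map_one]
  refine le_iInf fun h => ?_
  lift l to ℝ≥0 using hl.le
  have hl' : 0 < l := by exact_mod_cast hl
  rw [← NNReal.coe_inv] at h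
  rw [ENNReal.ofReal_coe_nnreal, mul_comm]
  exact (weightedNorm_le φ W x hl').trans (by gcongr; exact hW.mono h)

/-- `(x + y)/(l + k)` is the convex combination of `x/l` and `y/k` with weights `l/(l + k)` and
`k/(l + k)`; convexity of `φ` and then of `W` gives the claim. -/
theorem weightedNorm_add_le (hφ : IsOrliczFunction φ) (hW : IsNormWeight W) (x y : Ω →ₘ[μ] 𝕜) :
    weightedNorm φ W (x + y) ≤ weightedNorm φ W x + weightedNorm φ W y := by
  have key : ∀ l : ℝ≥0, 0 < l → ∀ k : ℝ≥0, 0 < k → weightedNorm φ W (x + y) ≤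
      l * W (modular φ (((l⁻¹ : ℝ≥0) : ℝ) • x)) + k * W (modular φ (((k⁻¹ : ℝ≥0) : ℝ) • y)) := by
    intro l hl k hk
    have hlk : 0 < l + k := add_pos hl hk
    have e1 : (l + k) * (l / (l + k)) = l := mul_div_cancel₀ _ hlk.ne'
    have e2 : (l + k) * (k / (l + k)) = k := mul_div_cancel₀ _ hlk.ne'
    have hab : l / (l + k) + k / (l + k) = 1 := by rw [← add_div, div_self hlk.ne']
    refine (weightedNorm_le φ W (x + y) hlk).trans ?_
    have h1 := modular_convex_comb_le hφ hab (c := l⁻¹) (d := k⁻¹) (e := (l + k)⁻¹)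
      (by field_simp) (by field_simp) x y
    calc ((l + k : ℝ≥0) : ℝ≥0∞) * W (modular φ ((((l + k)⁻¹ : ℝ≥0) : ℝ) • (x + y)))
        ≤ ((l + k : ℝ≥0) : ℝ≥0∞) * (((l / (l + k) : ℝ≥0) : ℝ≥0∞) *
            W (modular φ (((l⁻¹ : ℝ≥0) : ℝ) • x)) + ((k / (l + k) : ℝ≥0) : ℝ≥0∞) *
            W (modular φ (((k⁻¹ : ℝ≥0) : ℝ) • y))) := by
          gcongr
          exact (hW.mono h1).trans (hW.convex _ _ _ _ hab)
      _ = _ := by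
          rw [mul_add, ← mul_assoc, ← mul_assoc, ← ENNReal.coe_mul, ← ENNReal.coe_mul, e1, e2]
  conv_rhs => unfold weightedNorm
  simp only [ENNReal.iInf_add, ENNReal.add_iInf]
  exact le_iInf₂ fun l hl => le_iInf₂ fun k hk => key _ ‹_› _ ‹_›

theorem weightedNorm_zero (hW : IsNormWeight W) (h0 : φ 0 = 0) :
    weightedNorm φ W (0 : Ω →ₘ[μ] 𝕜) = 0 := by
  have h : ∀ l : ℝ≥0, modular φ ((l : ℝ) • (0 : Ω →ₘ[μ] 𝕜)) = 0 := by
    intro l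
    rw [modular_coe_smul]
    refine (lintegral_congr_ae ?_).trans lintegral_zero
    filter_upwards [AEEqFun.coeFn_zero (α := Ω) (β := 𝕜) (μ := μ)] with t ht
    simp [ht, h0]
  refine le_antisymm (ENNReal.le_of_forall_pos_le_add fun ε hε _ => ?_) zero_le
  refine (weightedNorm_le φ W 0 hε).trans ?_
  rw [h, hW.map_zero]
  simp

theorem weightedNorm_smul (hW : IsNormWeight W) (h0 : φ 0 = 0) (c : 𝕜) (x : Ω →ₘ[μ] 𝕜) :
    weightedNorm φ W (c • x) = ‖c‖ₑ * weightedNorm φ W x := by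
  -- One inequality follows from the substitution `l ↦ ‖c‖ l`; applying it to `c⁻¹` and `c • x`
  -- gives the other.
  have key : ∀ (c : 𝕜) (x : Ω →ₘ[μ] 𝕜), c ≠ 0 →
      weightedNorm φ W (c • x) ≤ ‖c‖ₑ * weightedNorm φ W x := by
    intro c x hc
    have hc' : 0 < ‖c‖₊ := nnnorm_pos.2 hc
    have hce : ‖c‖ₑ ≠ 0 := enorm_ne_zero.2 hc
    conv_rhs => unfold weightedNorm
    rw [ENNReal.mul_iInf_of_ne hce enorm_ne_top]
    refine le_iInf fun l => ?_
    rw [ENNReal.mul_iInf_of_ne hce enorm_ne_top]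
    refine le_iInf fun hl => ?_
    refine (weightedNorm_le φ W (c • x) (mul_pos hc' hl)).trans_eq ?_
    rw [modular_coe_smul_smul, ENNReal.coe_mul, mul_assoc]
    congr 5
    field_simp
  rcases eq_or_ne c 0 with rfl | hc
  · rw [show (0 : 𝕜) • x = 0 from zero_smul 𝕜 x, weightedNorm_zero hW h0]
    simp
  refine le_antisymm (key c x hc) ?_
  have h := key c⁻¹ (c • x) (inv_ne_zero hc)
  rw [inv_smul_smul₀ hc] at h
  have hce : ‖c‖ₑ ≠ 0 := enorm_ne_zero.2 hc
  calc ‖c‖ₑ * weightedNorm φ W x ≤ ‖c‖ₑ * (‖c⁻¹‖ₑ * weightedNorm φ W (c • x)) := by gcongr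
    _ = weightedNorm φ W (c • x) := by
      rw [enorm_inv hc, ← mul_assoc, ENNReal.mul_inv_cancel hce enorm_ne_top, one_mul]

end

/-! ### Completeness of the Orlicz space -/

section

variable {Ω : Type*} [MeasurableSpace Ω] {𝕜 : Type*} [RCLike 𝕜] {μ : Measure Ω}
  {φ : ℝ≥0 → ℝ≥0∞} {W : ℝ≥0∞ → ℝ≥0∞}

theorem mem_orliczCarrier_iff (hφ : IsOrliczFunction φ) (x : Ω →ₘ[μ] 𝕜) :
    x ∈ (orliczCarrier φ : Set (Ω →ₘ[μ] 𝕜)) ↔ luxemburgNorm φ x < ⊤ := by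
  constructor
  · rintro ⟨l, hl, h⟩
    lift l to ℝ≥0 using hl.le
    have hl' : 0 < l := by exact_mod_cast hl
    obtain ⟨m, hm⟩ : ∃ m : ℝ≥0, (m : ℝ≥0∞) = modular φ ((l : ℝ) • x) :=
      ⟨_, ENNReal.coe_toNNReal h.ne⟩
    have h1 : (1 : ℝ≥0) ≤ max 1 m := le_max_left _ _
    have hpos : 0 < max 1 m := zero_lt_one.trans_le h1
    refine (luxemburgNorm_le x (l := ((max 1 m)⁻¹ * l)⁻¹)
      (inv_pos.2 (mul_pos (inv_pos.2 hpos) hl')) ?_).trans_lt ENNReal.coe_lt_top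
    rw [inv_inv]
    refine (modular_mul_smul_le hφ (inv_le_one_of_one_le₀ h1) l x).trans ?_
    rw [← hm]
    norm_cast
    rw [inv_mul_le_one₀ hpos]
    exact le_max_right _ _
  · intro h
    obtain ⟨l, hl⟩ := ENNReal.lt_iff_exists_nnreal_btwn.1 h
    have hpos : 0 < l := by exact_mod_cast zero_le.trans_lt hl.1
    exact ⟨((l⁻¹ : ℝ≥0) : ℝ), by exact_mod_cast inv_pos.2 hpos,
      (modular_le_one_of_luxemburgNorm_lt hφ.mono hl.1).trans_lt ENNReal.one_lt_top⟩

theorem mem_orliczCarrier_iff_weightedNorm (hφ : IsOrliczFunction φ) (hW : IsNormWeight W)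
    (x : Ω →ₘ[μ] 𝕜) :
    x ∈ (orliczCarrier φ : Set (Ω →ₘ[μ] 𝕜)) ↔ weightedNorm φ W x < ⊤ := by
  rw [mem_orliczCarrier_iff hφ]
  refine ⟨fun h => (weightedNorm_le_mul_luxemburgNorm hW x).trans_lt
    (ENNReal.mul_lt_top hW.map_one.lt_top h),
    fun h => (luxemburgNorm_le_weightedNorm hφ hW x).trans_lt h⟩

/-- Smallness of the Luxemburg–Nakano norm implies smallness in measure. -/
theorem exists_measure_le_of_luxemburgNorm_lt (hφ : IsOrliczFunction φ) {δ : ℝ≥0} (hδ : 0 < δ)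
    (N : ℝ≥0) :
    ∃ ε : ℝ≥0, 0 < ε ∧ ∀ x : Ω →ₘ[μ] 𝕜, luxemburgNorm φ x < ε →
      μ {t | δ ≤ ‖x t‖₊} ≤ (N : ℝ≥0∞)⁻¹ := by
  obtain ⟨v, hv, hNv⟩ := hφ.exists_le N
  -- With `φ v ≥ N`, the integrand `φ(v|x|/δ)` is at least `N` where `|x| ≥ δ`, and Chebyshev's
  -- inequality applies.
  refine ⟨δ / v, div_pos hδ hv, fun x hx => ?_⟩
  have h1 := modular_le_one_of_luxemburgNorm_lt hφ.mono hx
  rw [modular_coe_smul] at h1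
  have hmeas : Measurable fun t => φ ((δ / v)⁻¹ * ‖x t‖₊) :=
    hφ.mono.measurable.comp (x.measurable.nnnorm.const_mul _)
  have h2 := (mul_meas_ge_le_lintegral hmeas (N : ℝ≥0∞)).trans h1
  rw [ENNReal.le_inv_iff_mul_le, mul_comm]
  refine le_trans ?_ h2
  gcongr with t
  intro ht
  refine hNv.trans (hφ.mono ?_)
  rw [inv_div, div_mul_eq_mul_div, le_div_iff₀ hδ]
  gcongr

theorem eq_zero_of_luxemburgNorm_eq_zero (hφ : IsOrliczFunction φ) {x : Ω →ₘ[μ] 𝕜}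
    (hx : luxemburgNorm φ x = 0) : x = 0 := by
  have h : ∀ n : ℕ, μ {t | ((n : ℝ≥0) + 1)⁻¹ ≤ ‖x t‖₊} = 0 := by
    intro n
    refine le_antisymm (ENNReal.le_of_forall_pos_le_add fun c hc _ => ?_) zero_le
    obtain ⟨ε, hε, h⟩ := exists_measure_le_of_luxemburgNorm_lt (𝕜 := 𝕜) (μ := μ) hφ
      (δ := ((n : ℝ≥0) + 1)⁻¹) (by positivity) c⁻¹
    have := h x (by rw [hx]; exact_mod_cast hε)
    rwa [ENNReal.coe_inv hc.ne', inv_inv, ← zero_add (c : ℝ≥0∞)] at this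
  have h' : ∀ᵐ t ∂μ, ∀ n : ℕ, ¬ ((n : ℝ≥0) + 1)⁻¹ ≤ ‖x t‖₊ :=
    ae_all_iff.2 fun n => by
      rw [ae_iff]
      simpa only [not_not] using h n
  refine AEEqFun.ext ?_
  filter_upwards [h', AEEqFun.coeFn_zero (α := Ω) (β := 𝕜) (μ := μ)] with t ht h0
  rw [h0, Pi.zero_apply]
  by_contra hne
  obtain ⟨n, hn⟩ := exists_nat_one_div_lt (nnnorm_pos.2 hne)
  exact ht n (by rw [← one_div]; exact hn.le)

/-- A value exceeded at `a` is already exceeded at some `b < a`, hence on the neighbourhood `(b,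
∞)`. Fatou's lemma for the modular rests on this. -/
theorem lowerSemicontinuous_of_monotone_of_leftContinuous (hm : Monotone φ)
    (hl : IsLeftContinuous φ) : LowerSemicontinuous φ := by
  intro a c hc
  rcases eq_or_ne a 0 with rfl | ha
  · exact Eventually.of_forall fun b => hc.trans_le (hm zero_le)
  have : (𝓝[<] a).NeBot := by
    exact nhdsLT_neBot_of_exists_lt ⟨0, pos_iff_ne_zero.2 ha⟩
  obtain ⟨b, hb, hba⟩ := (((hl a).tendsto.eventually (lt_mem_nhds hc)).and
    self_mem_nhdsWithin).exists
  filter_upwards [lt_mem_nhds hba] with d hd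
  exact hb.trans_le (hm hd.le)

/-- A sequence which is Cauchy in the Luxemburg–Nakano norm has a subsequence converging a.e. -/
theorem exists_subseq_tendsto_ae (hφ : IsOrliczFunction φ) {u : ℕ → Ω →ₘ[μ] 𝕜}
    (hu : ∀ ε : ℝ≥0∞, 0 < ε → ∃ n₀, ∀ m ≥ n₀, ∀ n ≥ n₀, luxemburgNorm φ (u m - u n) < ε) :
    ∃ f : ℕ → ℕ, StrictMono f ∧ ∃ x : Ω →ₘ[μ] 𝕜,
      ∀ᵐ t ∂μ, Tendsto (fun k => u (f k) t) atTop (𝓝 (x t)) := by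
  have hε : ∀ k : ℕ, ∃ ε : ℝ≥0, 0 < ε ∧ ∀ x : Ω →ₘ[μ] 𝕜, luxemburgNorm φ x < ε →
      μ {t | (2⁻¹ : ℝ≥0) ^ k ≤ ‖x t‖₊} ≤ (((2 : ℝ≥0) ^ k : ℝ≥0) : ℝ≥0∞)⁻¹ := fun k =>
    exists_measure_le_of_luxemburgNorm_lt hφ (by positivity) _
  choose ε hε0 hε using hε
  obtain ⟨f, hf, hfε⟩ := extraction_forall_of_eventually (P := fun k N =>
    ∀ m ≥ N, ∀ n ≥ N, luxemburgNorm φ (u m - u n) < ε k) (fun k => by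
      obtain ⟨n₀, h⟩ := hu (ε k) (by exact_mod_cast hε0 k)
      filter_upwards [eventually_ge_atTop n₀] with N hN m hm n hn
      exact h m (hN.trans hm) n (hN.trans hn))
  refine ⟨f, hf, ?_⟩
  have hmeas : ∀ k, μ {t | (2⁻¹ : ℝ≥0) ^ k ≤ ‖(u (f (k + 1)) - u (f k)) t‖₊} ≤
      (2⁻¹ : ℝ≥0∞) ^ k := by
    intro k
    refine (hε k _ (hfε k _ (hf.monotone (Nat.le_succ k)) _ le_rfl)).trans_eq ?_
    rw [ENNReal.coe_pow, ← ENNReal.inv_pow]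
    rfl
  have hsum : ∑' k, μ {t | (2⁻¹ : ℝ≥0) ^ k ≤ ‖(u (f (k + 1)) - u (f k)) t‖₊} ≠ ⊤ := by
    refine ne_top_of_le_ne_top ?_ (ENNReal.tsum_le_tsum hmeas)
    rw [ENNReal.tsum_geometric]
    simp
  -- Borel–Cantelli: at almost every point the consecutive differences are eventually below
  -- `2^(-k)`, so the subsequence is Cauchy there.
  have hlim : ∀ᵐ t ∂μ, ∃ l, Tendsto (fun k => u (f k) t) atTop (𝓝 l) := by
    have hsubs : ∀ᵐ t ∂μ, ∀ k, (u (f (k + 1)) - u (f k)) t = u (f (k + 1)) t - u (f k) t :=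
      ae_all_iff.2 fun k => AEEqFun.coeFn_sub _ _
    filter_upwards [ae_eventually_notMem hsum, hsubs] with t ht hs
    refine cauchySeq_tendsto_of_complete (cauchySeq_of_summable_dist ?_)
    refine Summable.of_norm_bounded_eventually_nat (g := fun k => (1 / 2 : ℝ) ^ k)
      summable_geometric_two ?_
    filter_upwards [ht] with k hk
    have hk' : ‖(u (f (k + 1)) - u (f k)) t‖₊ < (2⁻¹ : ℝ≥0) ^ k := not_le.1 hk
    rw [hs] at hk'
    have h3 : ‖u (f (k + 1)) t - u (f k) t‖ < (2⁻¹ : ℝ) ^ k := by exact_mod_cast hk'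
    rw [Real.norm_of_nonneg dist_nonneg, dist_comm, dist_eq_norm, one_div]
    exact h3.le
  obtain ⟨g, hg, hgl⟩ := exists_stronglyMeasurable_limit_of_tendsto_ae
    (fun k => (u (f k)).aestronglyMeasurable) hlim
  refine ⟨AEEqFun.mk g hg.aestronglyMeasurable, ?_⟩
  filter_upwards [hgl, AEEqFun.coeFn_mk g hg.aestronglyMeasurable] with t h1 h2
  rwa [h2]

/-- The Fatou property of the modular. -/
theorem modular_coe_smul_le_of_tendsto_ae (hm : Monotone φ) (hl : IsLeftContinuous φ) (c : ℝ≥0)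
    {v : ℕ → Ω →ₘ[μ] 𝕜} {y : Ω →ₘ[μ] 𝕜} (hv : ∀ᵐ t ∂μ, Tendsto (fun k => v k t) atTop (𝓝 (y t)))
    {B : ℝ≥0∞} (hB : ∀ᶠ k in atTop, modular φ ((c : ℝ) • v k) ≤ B) :
    modular φ ((c : ℝ) • y) ≤ B := by
  have hlsc := lowerSemicontinuous_of_monotone_of_leftContinuous hm hl
  calc modular φ ((c : ℝ) • y) = ∫⁻ t, φ (c * ‖y t‖₊) ∂μ := modular_coe_smul φ c y
    _ ≤ ∫⁻ t, liminf (fun k => φ (c * ‖v k t‖₊)) atTop ∂μ := by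
        refine lintegral_mono_ae ?_
        filter_upwards [hv] with t ht
        have h1 : Tendsto (fun k => c * ‖v k t‖₊) atTop (𝓝 (c * ‖y t‖₊)) := ht.nnnorm.const_mul c
        exact (hlsc.le_liminf _).trans h1.liminf_le_liminf_comp
    _ ≤ liminf (fun k => ∫⁻ t, φ (c * ‖v k t‖₊) ∂μ) atTop :=
        lintegral_liminf_le fun k => hm.measurable.comp ((v k).measurable.nnnorm.const_mul c)
    _ ≤ B := by
        refine liminf_le_of_frequently_le' (Eventually.frequently ?_)
        filter_upwards [hB] with k hk
        rwa [modular_coe_smul] at hk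

/-- For fixed `n`, the differences `u n - u (f k)` tend a.e. to `u n - x`, and Fatou carries the
bound `I_φ(·/e) ≤ 1` to the limit. -/
theorem exists_tendsto_luxemburgNorm (hφ : IsOrliczFunction φ) (hl : IsLeftContinuous φ)
    {u : ℕ → Ω →ₘ[μ] 𝕜}
    (hu : ∀ ε : ℝ≥0∞, 0 < ε → ∃ n₀, ∀ m ≥ n₀, ∀ n ≥ n₀, luxemburgNorm φ (u m - u n) < ε) :
    ∃ x : Ω →ₘ[μ] 𝕜, Tendsto (fun n => luxemburgNorm φ (u n - x)) atTop (𝓝 0) := by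
  obtain ⟨f, hf, x, hx⟩ := exists_subseq_tendsto_ae hφ hu
  refine ⟨x, ENNReal.tendsto_atTop_zero.2 fun ε hε => ?_⟩
  obtain ⟨e, he0, heε⟩ := ENNReal.lt_iff_exists_nnreal_btwn.1 hε
  have he : 0 < e := by exact_mod_cast he0
  obtain ⟨n₀, hn₀⟩ := hu e he0
  refine ⟨n₀, fun n hn => (luxemburgNorm_le _ he ?_).trans heε.le⟩
  refine modular_coe_smul_le_of_tendsto_ae hφ.mono hl _ (v := fun k => u n - u (f k)) ?_ ?_
  · have hsubs : ∀ᵐ t ∂μ, ∀ k, (u n - u (f k)) t = u n t - u (f k) t :=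
      ae_all_iff.2 fun k => AEEqFun.coeFn_sub _ _
    filter_upwards [hx, hsubs, AEEqFun.coeFn_sub (u n) x] with t h1 h2 h3
    rw [h3]
    simp only [h2]
    exact tendsto_const_nhds.sub h1
  · filter_upwards [hf.tendsto_atTop.eventually_ge_atTop n₀] with k hk
    exact modular_le_one_of_luxemburgNorm_lt hφ.mono (hn₀ n hn _ hk)

theorem isBanach_weightedNorm (hφ : IsOrliczFunction φ) (hl : IsLeftContinuous φ)
    (hW : IsNormWeight W) :
    FnSpace.IsBanach (⟨orliczCarrier φ, weightedNorm φ W⟩ : FnSpace 𝕜 μ) := by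
  have mem := mem_orliczCarrier_iff_weightedNorm (𝕜 := 𝕜) (μ := μ) hφ hW
  have hadd : ∀ x ∈ (orliczCarrier φ : Set (Ω →ₘ[μ] 𝕜)), ∀ y ∈ (orliczCarrier φ : Set (Ω →ₘ[μ] 𝕜)),
      x + y ∈ (orliczCarrier φ : Set (Ω →ₘ[μ] 𝕜)) := by
    intro x hx y hy
    rw [mem] at hx hy ⊢
    exact (weightedNorm_add_le hφ hW x y).trans_lt (ENNReal.add_lt_top.2 ⟨hx, hy⟩)
  have hsmul : ∀ (c : 𝕜), ∀ x ∈ (orliczCarrier φ : Set (Ω →ₘ[μ] 𝕜)),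
      c • x ∈ (orliczCarrier φ : Set (Ω →ₘ[μ] 𝕜)) := by
    intro c x hx
    rw [mem] at hx ⊢
    rw [weightedNorm_smul hW hφ.map_zero]
    exact ENNReal.mul_lt_top enorm_lt_top hx
  refine ⟨?_, hadd, hsmul, fun x hx => (mem x).1 hx, fun x _ => ?_,
    fun x _ y _ => weightedNorm_add_le hφ hW x y,
    fun c x _ => weightedNorm_smul hW hφ.map_zero c x, ?_⟩
  · change (0 : Ω →ₘ[μ] 𝕜) ∈ (orliczCarrier φ : Set (Ω →ₘ[μ] 𝕜))
    rw [mem, weightedNorm_zero hW hφ.map_zero]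
    exact ENNReal.zero_lt_top
  · refine ⟨fun h => eq_zero_of_luxemburgNorm_eq_zero hφ ?_, fun h => ?_⟩
    · exact le_antisymm ((luxemburgNorm_le_weightedNorm hφ hW x).trans_eq h) zero_le
    · rw [h]; exact weightedNorm_zero hW hφ.map_zero
  · intro u hu hc
    obtain ⟨x, hx⟩ := exists_tendsto_luxemburgNorm hφ hl (u := u) fun ε hε => by
      obtain ⟨n₀, h⟩ := hc ε hε
      exact ⟨n₀, fun m hm n hn => (luxemburgNorm_le_weightedNorm hφ hW _).trans_lt (h m hm n hn)⟩
    have hx' : Tendsto (fun n => weightedNorm φ W (u n - x)) atTop (𝓝 0) := by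
      have h1 := ENNReal.Tendsto.const_mul hx (Or.inr hW.map_one)
      rw [mul_zero] at h1
      exact tendsto_of_tendsto_of_tendsto_of_le_of_le tendsto_const_nhds h1 (fun _ => zero_le)
        fun n => weightedNorm_le_mul_luxemburgNorm hW _
    refine ⟨x, ?_, hx'⟩
    obtain ⟨n, hn⟩ := (hx'.eventually (gt_mem_nhds ENNReal.zero_lt_top)).exists
    have h2 := hadd _ (hu n) _ (hsmul (-1) _ ((mem _).2 hn))
    have h3 : u n + (-1 : 𝕜) • (u n - x) = x := by
      rw [show (-1 : 𝕜) • (u n - x) = -(u n - x) from neg_one_smul 𝕜 (u n - x)]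
      abel
    rwa [h3] at h2

end

/-! ### The function `ρ_*` and convexity of `φ(u^(1/p))` -/

section

theorem rhoStar_zero (ρ : ℝ≥0 → ℝ≥0) : rhoStar ρ 0 = 0 := by simp [rhoStar]

theorem IsQuasiConcave.monotone_rhoStar {ρ : ℝ≥0 → ℝ≥0} (hρ : IsQuasiConcave ρ) :
    Monotone (rhoStar ρ) := by
  intro a b hab
  rcases eq_or_ne a 0 with rfl | ha
  · rw [rhoStar_zero]; exact zero_le
  have ha' : 0 < a := pos_iff_ne_zero.2 ha
  have hb' : 0 < b := ha'.trans_le hab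
  have h := hρ.le_max_mul (1 / a) (1 / b) (by positivity) (by positivity)
  have e : 1 / a / (1 / b) = b / a := by field_simp
  rw [e, max_eq_right ((one_le_div ha').2 hab)] at h
  calc a * ρ (1 / a) ≤ a * (b / a * ρ (1 / b)) := by gcongr
    _ = b * ρ (1 / b) := by field_simp

theorem IsQuasiConcave.mul_rhoStar_le {ρ : ℝ≥0 → ℝ≥0} (hρ : IsQuasiConcave ρ) {a b : ℝ≥0}
    (hab : a ≤ b) : a * rhoStar ρ b ≤ b * rhoStar ρ a := by
  rcases eq_or_ne a 0 with rfl | ha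
  · simp
  have ha' : 0 < a := pos_iff_ne_zero.2 ha
  have hb' : 0 < b := ha'.trans_le hab
  have h := hρ.le_max_mul (1 / b) (1 / a) (by positivity) (by positivity)
  have e : 1 / b / (1 / a) = a / b := by field_simp
  rw [e, max_eq_left ((div_le_one hb').2 hab), one_mul] at h
  calc a * (b * ρ (1 / b)) ≤ a * (b * ρ (1 / a)) := by gcongr
    _ = b * (a * ρ (1 / a)) := by ring

/-- Concavity of `ρ` passes to its perspective `t ρ(1/t)`: the point `1/b` is the mean of `1/a` and
`1/c` with weights `(c-b)a/((c-a)b)` and `(b-a)c/((c-a)b)`. -/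
theorem chord_rhoStar_le {ρ : ℝ≥0 → ℝ≥0} (hρ : ConcaveOn ℝ≥0 univ ρ) {a b c : ℝ≥0} (ha : 0 < a)
    (hab : a < b) (hbc : b ≤ c) :
    ((c : ℝ) - b) * rhoStar ρ a + ((b : ℝ) - a) * rhoStar ρ c ≤ ((c : ℝ) - a) * rhoStar ρ b := by
  have hb : 0 < b := ha.trans hab
  have hc : 0 < c := hb.trans_le hbc
  have hac : a < c := hab.trans_le hbc
  have hac' : (0 : ℝ) < c - a := sub_pos.2 (by exact_mod_cast hac)
  have hd : 0 < (c - a) * b := mul_pos (tsub_pos_of_lt hac) hb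
  have ha0 : (a : ℝ) ≠ 0 := by exact_mod_cast ha.ne'
  have hb0 : (b : ℝ) ≠ 0 := by exact_mod_cast hb.ne'
  have hc0 : (c : ℝ) ≠ 0 := by exact_mod_cast hc.ne'
  set α : ℝ≥0 := (c - b) * a / ((c - a) * b) with hα
  set β : ℝ≥0 := (b - a) * c / ((c - a) * b) with hβ
  have eα : (α : ℝ) = (c - b) * a / ((c - a) * b) := by
    rw [hα]; push_cast [NNReal.coe_sub hbc, NNReal.coe_sub hac.le]; rfl
  have eβ : (β : ℝ) = (b - a) * c / ((c - a) * b) := by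
    rw [hβ]; push_cast [NNReal.coe_sub hab.le, NNReal.coe_sub hac.le]; rfl
  have hsum : α + β = 1 := by
    rw [← NNReal.coe_inj, NNReal.coe_add, eα, eβ, NNReal.coe_one]
    field_simp
    ring
  have h := hρ.2 (mem_univ (1 / a)) (mem_univ (1 / c)) (zero_le (a := α)) (zero_le (a := β)) hsum
  have hpt : α • (1 / a) + β • (1 / c) = 1 / b := by
    rw [← NNReal.coe_inj]
    simp only [smul_eq_mul, NNReal.coe_add, NNReal.coe_mul, NNReal.coe_div, NNReal.coe_one, eα, eβ]
    field_simp
    ring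
  rw [hpt] at h
  have h' : (α : ℝ) * ρ (1 / a) + β * ρ (1 / c) ≤ ρ (1 / b) := by exact_mod_cast h
  simp only [rhoStar, NNReal.coe_mul]
  have hmul := mul_le_mul_of_nonneg_left h' (mul_nonneg hac'.le b.coe_nonneg)
  rw [eα, eβ] at hmul
  calc ((c : ℝ) - b) * (a * ρ (1 / a)) + ((b : ℝ) - a) * (c * ρ (1 / c))
      = (c - a) * b * ((c - b) * a / ((c - a) * b) * ρ (1 / a) +
          (b - a) * c / ((c - a) * b) * ρ (1 / c)) := by
        field_simp
    _ ≤ _ := hmul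
    _ = _ := by ring

/-- An affine function with nonnegative coefficients which agrees with `ρ_*` at an intermediate
point and dominates it at the two end points. -/
theorem exists_affine_ge_rhoStar {ρ : ℝ≥0 → ℝ≥0} (hρ : IsConcaveQuasiConcave ρ) {a b c : ℝ≥0}
    (hb : 0 < b) (hab : a ≤ b) (hbc : b ≤ c) :
    ∃ k d : ℝ≥0, rhoStar ρ b = k * b + d ∧ rhoStar ρ a ≤ k * a + d ∧ rhoStar ρ c ≤ k * c + d := by
  -- No chord over `0 < a < b` exists here; the line through the origin serves instead, because
  -- `ρ_*(t)/t` is nonincreasing.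
  by_cases hcase : a = 0 ∨ a = b
  · refine ⟨rhoStar ρ b / b, 0, ?_, ?_, ?_⟩
    · rw [add_zero, div_mul_cancel₀ _ hb.ne']
    · rcases hcase with rfl | rfl
      · rw [rhoStar_zero]; exact zero_le
      · rw [add_zero, div_mul_cancel₀ _ hb.ne']
    · rw [add_zero, div_mul_eq_mul_div, le_div_iff₀ hb, mul_comm, mul_comm _ c]
      exact hρ.1.mul_rhoStar_le hbc
  push Not at hcase
  have ha : 0 < a := pos_iff_ne_zero.2 hcase.1
  have hab' : a < b := lt_of_le_of_ne hab hcase.2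
  have hba : (0 : ℝ) < b - a := sub_pos.2 (by exact_mod_cast hab')
  have h1 : (a : ℝ) * rhoStar ρ b ≤ b * rhoStar ρ a := by exact_mod_cast hρ.1.mul_rhoStar_le hab
  have h2 : (rhoStar ρ a : ℝ) ≤ rhoStar ρ b := by exact_mod_cast hρ.1.monotone_rhoStar hab
  have h3 := chord_rhoStar_le hρ.2 ha hab' hbc
  -- The line through the points of the graph over `a` and `b`. Its slope is nonnegative since `ρ_*`
  -- increases, its intercept since `ρ_*(t)/t` decreases, and concavity puts the graph below it at
  -- `c`.
  set k : ℝ := (rhoStar ρ b - rhoStar ρ a) / (b - a) with hk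
  set d : ℝ := (b * rhoStar ρ a - a * rhoStar ρ b) / (b - a) with hd
  have hk0 : 0 ≤ k := div_nonneg (sub_nonneg.2 h2) hba.le
  have hd0 : 0 ≤ d := div_nonneg (sub_nonneg.2 h1) hba.le
  refine ⟨⟨k, hk0⟩, ⟨d, hd0⟩, ?_, ?_, ?_⟩
  · rw [← NNReal.coe_inj]
    change (rhoStar ρ b : ℝ) = k * b + d
    rw [hk, hd]; field_simp; ring
  · rw [← NNReal.coe_le_coe]
    change (rhoStar ρ a : ℝ) ≤ k * a + d
    refine le_of_eq ?_
    rw [hk, hd]; field_simp; ring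
  · rw [← NNReal.coe_le_coe]
    change (rhoStar ρ c : ℝ) ≤ k * c + d
    rw [hk, hd, div_mul_eq_mul_div, ← add_div, le_div_iff₀ hba]
    linarith

/-- Concavity of `v ↦ (k v ^ (1/p) + d) ^ p`, in the form of Minkowski's inequality. -/
theorem affine_rpow_mean_le {p : ℝ} (hp : 1 ≤ p) (k d : ℝ≥0) {α β : ℝ≥0} (hαβ : α + β = 1)
    (v w : ℝ≥0) :
    α * (k * v + d) ^ p + β * (k * w + d) ^ p ≤ (k * (α * v ^ p + β * w ^ p) ^ (1 / p) + d) ^ p := by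
  have hp0 : p ≠ 0 := (zero_lt_one.trans_le hp).ne'
  have hinv : ∀ a : ℝ≥0, (a ^ (1 / p)) ^ p = a := fun a => by
    rw [← NNReal.rpow_mul, one_div_mul_cancel hp0, NNReal.rpow_one]
  have hinv' : ∀ a : ℝ≥0, (a ^ p) ^ (1 / p) = a := fun a => by
    rw [← NNReal.rpow_mul, mul_one_div_cancel hp0, NNReal.rpow_one]
  -- Minkowski in two dimensions; the factors `α^(1/p)` and `β^(1/p)` encode the weights of the
  -- mean.
  have h := NNReal.Lp_add_le Finset.univ
    ![α ^ (1 / p) * (k * v), β ^ (1 / p) * (k * w)] ![α ^ (1 / p) * d, β ^ (1 / p) * d] hp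
  simp only [Fin.sum_univ_two, Matrix.cons_val_zero, Matrix.cons_val_one, ← mul_add,
    NNReal.mul_rpow, hinv] at h
  have e1 : (α * (k ^ p * v ^ p) + β * (k ^ p * w ^ p)) ^ (1 / p) =
      k * (α * v ^ p + β * w ^ p) ^ (1 / p) := by
    rw [show α * (k ^ p * v ^ p) + β * (k ^ p * w ^ p) = k ^ p * (α * v ^ p + β * w ^ p) by ring,
      NNReal.mul_rpow, hinv']
  have e2 : (α * d ^ p + β * d ^ p) ^ (1 / p) = d := by
    rw [← add_mul, hαβ, one_mul, hinv']
  rw [e1, e2] at h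
  have h' := NNReal.rpow_le_rpow h (zero_le_one.trans hp)
  rwa [hinv] at h'

/-- Concavity of `t ↦ ρ_*(t^(1/p))^p`: replace `ρ_*` by an affine majorant touching it at the
`p`-mean `b` of `v` and `w`, for which the inequality is Minkowski's. -/
theorem rhoStar_rpow_mean_le {ρ : ℝ≥0 → ℝ≥0} (hρ : IsConcaveQuasiConcave ρ) {p : ℝ} (hp : 1 ≤ p)
    {α β : ℝ≥0} (hαβ : α + β = 1) (v w : ℝ≥0) :
    α * rhoStar ρ v ^ p + β * rhoStar ρ w ^ p ≤
      rhoStar ρ ((α * v ^ p + β * w ^ p) ^ (1 / p)) ^ p := by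
  wlog hvw : v ≤ w generalizing v w α β
  · have := this (by rwa [add_comm]) w v (le_of_not_ge hvw)
    rwa [add_comm (β * _), add_comm (β * _)] at this
  have hp0 : 0 < p := zero_lt_one.trans_le hp
  set b := (α * v ^ p + β * w ^ p) ^ (1 / p) with hb
  have hbp : b ^ p = α * v ^ p + β * w ^ p := by
    rw [hb, ← NNReal.rpow_mul, one_div_mul_cancel hp0.ne', NNReal.rpow_one]
  rcases eq_or_ne b 0 with hb0 | hb0
  · rw [hb0, NNReal.zero_rpow hp0.ne', eq_comm, add_eq_zero] at hbp
    have aux : ∀ {θ u : ℝ≥0}, θ * u ^ p = 0 → θ * rhoStar ρ u ^ p = 0 := by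
      intro θ u h
      rcases mul_eq_zero.1 h with h | h
      · rw [h, zero_mul]
      · rw [(NNReal.rpow_eq_zero hp0.ne').1 h, rhoStar_zero, NNReal.zero_rpow hp0.ne', mul_zero]
    rw [aux hbp.1, aux hbp.2, add_zero]
    exact zero_le
  have hvb : v ≤ b := by
    rw [← NNReal.rpow_le_rpow_iff hp0, hbp]
    calc v ^ p = α * v ^ p + β * v ^ p := by rw [← add_mul, hαβ, one_mul]
      _ ≤ _ := by gcongr
  have hbw : b ≤ w := by
    rw [← NNReal.rpow_le_rpow_iff hp0, hbp]
    calc α * v ^ p + β * w ^ p ≤ α * w ^ p + β * w ^ p := by gcongr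
      _ = w ^ p := by rw [← add_mul, hαβ, one_mul]
  obtain ⟨k, d, h1, h2, h3⟩ := exists_affine_ge_rhoStar hρ (pos_iff_ne_zero.2 hb0) hvb hbw
  calc α * rhoStar ρ v ^ p + β * rhoStar ρ w ^ p
      ≤ α * (k * v + d) ^ p + β * (k * w + d) ^ p := by gcongr
    _ ≤ (k * b + d) ^ p := affine_rpow_mean_le hp k d hαβ v w
    _ = rhoStar ρ b ^ p := by rw [h1]

variable {ρ : ℝ≥0 → ℝ≥0} {p : ℝ} {φ : ℝ≥0 → ℝ≥0∞}

/-- The substitution `u = w^p` turns `u^(1/p) ρ(u^(-1/p))` into `ρ_*(w)`. -/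
theorem map_rhoStar_eq_rpow (hp : 1 ≤ p) (h0 : φ 0 = 0)
    (h : ∀ u : ℝ≥0, 0 < u → φ (u ^ (1 / p) * ρ (u ^ (-(1 / p)))) = u) (w : ℝ≥0) :
    φ (rhoStar ρ w) = ((w ^ p : ℝ≥0) : ℝ≥0∞) := by
  have hp0 : p ≠ 0 := (zero_lt_one.trans_le hp).ne'
  rcases eq_or_ne w 0 with rfl | hw
  · rw [rhoStar_zero, h0, NNReal.zero_rpow hp0, ENNReal.coe_zero]
  have := h (w ^ p) (NNReal.rpow_pos (pos_iff_ne_zero.2 hw))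
  rwa [NNReal.rpow_neg, ← NNReal.rpow_mul, mul_one_div_cancel hp0, NNReal.rpow_one,
    ← one_div] at this

theorem strictMono_rhoStar (hρ : IsQuasiConcave ρ) (hp : 1 ≤ p)
    (h : ∀ w, φ (rhoStar ρ w) = ((w ^ p : ℝ≥0) : ℝ≥0∞)) : StrictMono (rhoStar ρ) := by
  refine hρ.monotone_rhoStar.strictMono_of_injective fun a b hab => ?_
  have h1 := h a
  rw [hab, h b, ENNReal.coe_inj] at h1
  exact (NNReal.rpow_left_injective (zero_lt_one.trans_le hp).ne' h1).symm

theorem surjective_rhoStar (h : rhoStar ρ '' Ioi 0 = Ioi 0) : Function.Surjective (rhoStar ρ) := by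
  intro v
  rcases eq_or_ne v 0 with rfl | hv
  · exact ⟨0, rhoStar_zero ρ⟩
  · have : v ∈ rhoStar ρ '' Ioi 0 := by rw [h]; exact pos_iff_ne_zero.2 hv
    exact ⟨this.choose, this.choose_spec.2⟩

theorem monotone_of_map_rhoStar (hp : 1 ≤ p) (hs : StrictMono (rhoStar ρ))
    (hsurj : Function.Surjective (rhoStar ρ))
    (h : ∀ w, φ (rhoStar ρ w) = ((w ^ p : ℝ≥0) : ℝ≥0∞)) : Monotone φ := by
  intro u v huv
  obtain ⟨a, rfl⟩ := hsurj u
  obtain ⟨b, rfl⟩ := hsurj v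
  rw [h, h, ENNReal.coe_le_coe]
  exact NNReal.rpow_le_rpow (hs.le_iff_le.1 huv) (zero_le_one.trans hp)

theorem continuous_of_map_rhoStar (hp : 1 ≤ p) (hs : StrictMono (rhoStar ρ))
    (hsurj : Function.Surjective (rhoStar ρ))
    (h : ∀ w, φ (rhoStar ρ w) = ((w ^ p : ℝ≥0) : ℝ≥0∞)) : Continuous φ := by
  -- A strictly increasing surjection is an order isomorphism, so its inverse is continuous.
  set R := hs.orderIsoOfSurjective (rhoStar ρ) hsurj
  have e : φ = fun v => ((R.symm v ^ p : ℝ≥0) : ℝ≥0∞) := by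
    ext1 v
    rw [← h]
    congr 1
    exact (R.apply_symm_apply v).symm
  rw [e]
  exact ENNReal.continuous_coe.comp
    ((NNReal.continuous_rpow_const (zero_le_one.trans hp)).comp R.symm.continuous)

/-- The inverse of an increasing concave function is convex. -/
theorem convexOn_rpow_of_map_rhoStar (hρ : IsConcaveQuasiConcave ρ) (hp : 1 ≤ p)
    (hm : Monotone φ) (hsurj : Function.Surjective (rhoStar ρ))
    (h : ∀ w, φ (rhoStar ρ w) = ((w ^ p : ℝ≥0) : ℝ≥0∞)) :
    ConvexOn ℝ≥0 univ (fun u : ℝ≥0 => φ (u ^ (1 / p))) := by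
  have hp0 : 0 < p := zero_lt_one.trans_le hp
  have hinv : ∀ a : ℝ≥0, (a ^ (1 / p)) ^ p = a := fun a => by
    rw [← NNReal.rpow_mul, one_div_mul_cancel hp0.ne', NNReal.rpow_one]
  refine ⟨convex_univ, fun u _ v _ α β _ _ hαβ => ?_⟩
  obtain ⟨a, ha⟩ := hsurj (u ^ (1 / p))
  obtain ⟨b, hb⟩ := hsurj (v ^ (1 / p))
  have key := rhoStar_rpow_mean_le hρ hp hαβ a b
  rw [ha, hb, hinv, hinv] at key
  have key' : (α * u + β * v) ^ (1 / p) ≤ rhoStar ρ ((α * a ^ p + β * b ^ p) ^ (1 / p)) := by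
    rw [← NNReal.rpow_le_rpow_iff hp0, hinv]
    exact key
  have := hm key'
  rw [h, hinv] at this
  simp only [smul_eq_mul, ENNReal.smul_def]
  rw [← ha, ← hb, h, h]
  exact_mod_cast this

/-- `φ(u)` is the convex function `φ(·^(1/p))` at `u^p`; the arithmetic mean is at most the `p`-mean
and `φ` is monotone. -/
theorem convexOn_of_convexOn_rpow (hp : 1 ≤ p) (hm : Monotone φ)
    (hc : ConvexOn ℝ≥0 univ (fun u : ℝ≥0 => φ (u ^ (1 / p)))) : ConvexOn ℝ≥0 univ φ := by
  have hp0 : 0 < p := zero_lt_one.trans_le hp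
  have hinv : ∀ a : ℝ≥0, (a ^ p) ^ (1 / p) = a := fun a => by
    rw [← NNReal.rpow_mul, mul_one_div_cancel hp0.ne', NNReal.rpow_one]
  refine ⟨convex_univ, fun u _ v _ α β hα hβ hαβ => ?_⟩
  have h := hc.2 (mem_univ (u ^ p)) (mem_univ (v ^ p)) hα hβ hαβ
  simp only [hinv] at h
  refine le_trans (hm ?_) h
  rw [← hinv (α • u + β • v)]
  gcongr
  exact NNReal.rpow_arith_mean_le_arith_mean2_rpow α β u v hαβ hp

theorem isOrliczFunction_of_map_rhoStar (hρ : IsConcaveQuasiConcave ρ) (hp : 1 ≤ p)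
    (hs : StrictMono (rhoStar ρ)) (hsurj : Function.Surjective (rhoStar ρ)) (h0 : φ 0 = 0)
    (h : ∀ w, φ (rhoStar ρ w) = ((w ^ p : ℝ≥0) : ℝ≥0∞)) : IsOrliczFunction φ := by
  have hm := monotone_of_map_rhoStar hp hs hsurj h
  have h1 : 0 < rhoStar ρ 1 := by
    rw [← rhoStar_zero ρ]; exact hs zero_lt_one
  refine ⟨hm, convexOn_of_convexOn_rpow hp hm (convexOn_rpow_of_map_rhoStar hρ hp hm hsurj h), h0,
    ?_, ⟨_, h1, ?_⟩, ⟨_, h1, ?_⟩⟩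
  · have := (continuous_of_map_rhoStar hp hs hsurj h).tendsto 0
    rw [h0] at this
    exact this.mono_left nhdsWithin_le_nhds
  · rw [h]; simp
  · rw [h]; simp

end

/-! ### Embeddings and the interpolation property -/

section

variable {Ω : Type*} [MeasurableSpace Ω] {𝕜 : Type*} [RCLike 𝕜] {μ : Measure Ω}
  {φ : ℝ≥0 → ℝ≥0∞} {W : ℝ≥0∞ → ℝ≥0∞} {p : ℝ≥0}

/-- Convexity of `φ(·^(1/p))` between `0` and `v^p`. It compares `φ` with `φ(1) u^p` on either side
of `u = 1`, whence both embeddings. -/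
theorem map_mul_le_rpow_mul (hp : 1 ≤ p) (h0 : φ 0 = 0)
    (hc : ConvexOn ℝ≥0 univ (fun u : ℝ≥0 => φ (u ^ (1 / (p : ℝ))))) {a : ℝ≥0} (ha : a ≤ 1)
    (v : ℝ≥0) : φ (a * v) ≤ ((a ^ (p : ℝ) : ℝ≥0) : ℝ≥0∞) * φ v := by
  have hp' : (1 : ℝ) ≤ p := by exact_mod_cast hp
  have hp0 : (p : ℝ) ≠ 0 := (zero_lt_one.trans_le hp').ne'
  have hinv : ∀ a : ℝ≥0, (a ^ (p : ℝ)) ^ (1 / (p : ℝ)) = a := fun a => by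
    rw [← NNReal.rpow_mul, mul_one_div_cancel hp0, NNReal.rpow_one]
  have h1 : a ^ (p : ℝ) ≤ 1 := NNReal.rpow_le_one ha p.coe_nonneg
  have h := hc.2 (mem_univ (v ^ (p : ℝ))) (mem_univ 0) (zero_le (a := a ^ (p : ℝ)))
    (zero_le (a := 1 - a ^ (p : ℝ))) (add_tsub_cancel_of_le h1)
  simp only [smul_eq_mul, mul_zero, add_zero, ← NNReal.mul_rpow, hinv, ENNReal.smul_def] at h
  rwa [NNReal.zero_rpow (one_div_ne_zero hp0), h0, mul_zero, add_zero] at h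

theorem luxemburgNorm_le_mul_interNrm (hp : 1 ≤ p) (hφ : IsOrliczFunction φ)
    (hc : ConvexOn ℝ≥0 univ (fun u : ℝ≥0 => φ (u ^ (1 / (p : ℝ))))) (h1 : φ 1 ≠ ⊤)
    {x : Ω →ₘ[μ] 𝕜}
    (hx : x ∈ (FnSpace.lebesgue 𝕜 μ p).carrier ∩ (FnSpace.lebesgue 𝕜 μ ⊤).carrier) :
    luxemburgNorm φ x ≤ ((max 1 (φ 1).toNNReal : ℝ≥0) : ℝ≥0∞) *
      FnSpace.interNrm (FnSpace.lebesgue 𝕜 μ p) (FnSpace.lebesgue 𝕜 μ ⊤) x := by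
  set m : ℝ≥0 := max 1 (φ 1).toNNReal with hm
  have hm1 : 1 ≤ m := le_max_left _ _
  have hmpos : 0 < m := zero_lt_one.trans_le hm1
  have hφm : φ 1 ≤ m := by
    rw [← ENNReal.coe_toNNReal h1, ENNReal.coe_le_coe]; exact le_max_right _ _
  have hle0 : eLpNorm x p μ ≤
      FnSpace.interNrm (FnSpace.lebesgue 𝕜 μ p) (FnSpace.lebesgue 𝕜 μ ⊤) x := le_max_left _ _
  have hle1 : eLpNorm x ⊤ μ ≤
      FnSpace.interNrm (FnSpace.lebesgue 𝕜 μ p) (FnSpace.lebesgue 𝕜 μ ⊤) x := le_max_right _ _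
  have hfin : FnSpace.interNrm (FnSpace.lebesgue 𝕜 μ p) (FnSpace.lebesgue 𝕜 μ ⊤) x ≠ ⊤ :=
    (max_lt (Lp.mem_Lp_iff_eLpNorm_lt_top.1 hx.1) (Lp.mem_Lp_iff_eLpNorm_lt_top.1 hx.2)).ne
  lift FnSpace.interNrm (FnSpace.lebesgue 𝕜 μ p) (FnSpace.lebesgue 𝕜 μ ⊤) x to ℝ≥0
    using hfin with N
  rw [← ENNReal.coe_mul]
  refine ENNReal.le_of_forall_pos_le_add fun ε hε _ => ?_
  -- The increment keeps `δ` positive when `N = 0`, and it contributes exactly `ε` to `m δ`.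
  set δ : ℝ≥0 := N + ε / m with hδ
  have hδpos : 0 < δ := add_pos_of_nonneg_of_pos zero_le (div_pos hε hmpos)
  have hNδ : N ≤ δ := le_self_add
  have hbd : ∀ᵐ t ∂μ, δ⁻¹ * ‖x t‖₊ ≤ 1 := by
    rw [eLpNorm_exponent_top] at hle1
    filter_upwards [enorm_ae_le_eLpNormEssSup x μ] with t ht
    rw [inv_mul_le_one₀ hδpos]
    exact (ENNReal.coe_le_coe.1 (ht.trans hle1)).trans hNδ
  have hmod : modular φ (((δ⁻¹ : ℝ≥0) : ℝ) • x) ≤ φ 1 := by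
    rw [modular_coe_smul]
    calc ∫⁻ t, φ (δ⁻¹ * ‖x t‖₊) ∂μ
        ≤ ∫⁻ t, φ 1 * (((δ⁻¹) ^ (p : ℝ) : ℝ≥0) * ((‖x t‖₊ ^ (p : ℝ) : ℝ≥0) : ℝ≥0∞)) ∂μ := by
          refine lintegral_mono_ae ?_
          filter_upwards [hbd] with t ht
          have h := map_mul_le_rpow_mul hp hφ.map_zero hc ht 1
          rw [mul_one] at h
          rwa [← ENNReal.coe_mul, ← NNReal.mul_rpow, mul_comm (φ 1)]
      _ = φ 1 * ((((δ⁻¹) ^ (p : ℝ) : ℝ≥0) : ℝ≥0∞) * eLpNorm x p μ ^ (p : ℝ)) := by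
          rw [lintegral_const_mul' _ _ h1, lintegral_const_mul' _ _ ENNReal.coe_ne_top,
            eLpNorm_rpow_eq_lintegral hp]
      _ ≤ φ 1 * ((((δ⁻¹) ^ (p : ℝ) : ℝ≥0) : ℝ≥0∞) * (δ : ℝ≥0∞) ^ (p : ℝ)) := by
          gcongr
          exact hle0.trans (by exact_mod_cast hNδ)
      _ = φ 1 := by
          rw [← ENNReal.coe_rpow_of_nonneg _ p.coe_nonneg, ← ENNReal.coe_mul, ← NNReal.mul_rpow,
            inv_mul_cancel₀ hδpos.ne', NNReal.one_rpow, ENNReal.coe_one, mul_one]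
  have hfinal : luxemburgNorm φ x ≤ ((m * δ : ℝ≥0) : ℝ≥0∞) := by
    refine luxemburgNorm_le x (mul_pos hmpos hδpos) ?_
    rw [mul_inv]
    refine (modular_mul_smul_le hφ (inv_le_one_of_one_le₀ hm1) _ x).trans ?_
    rw [ENNReal.coe_inv hmpos.ne']
    calc (m : ℝ≥0∞)⁻¹ * modular φ (((δ⁻¹ : ℝ≥0) : ℝ) • x) ≤ (m : ℝ≥0∞)⁻¹ * m := by
          gcongr
          exact hmod.trans hφm
      _ = 1 := ENNReal.inv_mul_cancel (by simpa using hmpos.ne') ENNReal.coe_ne_top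
  refine hfinal.trans_eq ?_
  rw [hδ, mul_add, mul_div_cancel₀ _ hmpos.ne', ENNReal.coe_add]

theorem eLpNorm_sub_radialTrunc_le (hp : 1 ≤ p) (h0 : φ 0 = 0)
    (hc : ConvexOn ℝ≥0 univ (fun u : ℝ≥0 => φ (u ^ (1 / (p : ℝ))))) (h1 : φ 1 ≠ ⊤)
    (h1' : φ 1 ≠ 0) {x : Ω →ₘ[μ] 𝕜} {l : ℝ≥0} (hl : 0 < l)
    (hx : modular φ (((l⁻¹ : ℝ≥0) : ℝ) • x) ≤ 1) :
    eLpNorm (x - x.radialTrunc l) p μ ≤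
      ((l * (φ 1).toNNReal⁻¹ ^ (1 / (p : ℝ)) : ℝ≥0) : ℝ≥0∞) := by
  have hp' : (1 : ℝ) ≤ p := by exact_mod_cast hp
  have hp0 : 0 < (p : ℝ) := zero_lt_one.trans_le hp'
  have hf : (φ 1).toNNReal ≠ 0 := (ENNReal.toNNReal_pos h1' h1).ne'
  rw [← ENNReal.rpow_le_rpow_iff hp0, eLpNorm_rpow_eq_lintegral hp,
    ← ENNReal.coe_rpow_of_nonneg _ p.coe_nonneg, NNReal.mul_rpow, ← NNReal.rpow_mul _ (1 / (p : ℝ)),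
    one_div_mul_cancel hp0.ne', NNReal.rpow_one]
  -- For `a ≥ l`, the power bound with factor `l/a` at the point `a/l` reads `φ(1) ≤ (l/a)^p
  -- φ(a/l)`.
  have pt : ∀ a : ℝ≥0, (((a - l) ^ (p : ℝ) : ℝ≥0) : ℝ≥0∞) ≤
      ((l ^ (p : ℝ) * (φ 1).toNNReal⁻¹ : ℝ≥0) : ℝ≥0∞) * φ (l⁻¹ * a) := by
    intro a
    rcases le_total a l with h | h
    · rw [tsub_eq_zero_of_le h, NNReal.zero_rpow hp0.ne', ENNReal.coe_zero]
      exact zero_le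
    have ha : 0 < a := hl.trans_le h
    have hle : l / a ≤ 1 := (div_le_one ha).2 h
    have h2 := map_mul_le_rpow_mul hp h0 hc hle (l⁻¹ * a)
    rw [show l / a * (l⁻¹ * a) = 1 by field_simp] at h2
    have e3 : ((a ^ (p : ℝ) : ℝ≥0) : ℝ≥0∞) * (((l / a) ^ (p : ℝ) : ℝ≥0) : ℝ≥0∞) =
        ((l ^ (p : ℝ) : ℝ≥0) : ℝ≥0∞) := by
      rw [← ENNReal.coe_mul, ← NNReal.mul_rpow, mul_div_cancel₀ _ ha.ne']
    have e4 : (((φ 1).toNNReal⁻¹ : ℝ≥0) : ℝ≥0∞) * φ 1 = 1 := by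
      rw [ENNReal.coe_inv hf, ENNReal.coe_toNNReal h1, ENNReal.inv_mul_cancel h1' h1]
    calc (((a - l) ^ (p : ℝ) : ℝ≥0) : ℝ≥0∞) ≤ ((a ^ (p : ℝ) : ℝ≥0) : ℝ≥0∞) := by
          gcongr
          exact tsub_le_self
      _ = ((a ^ (p : ℝ) : ℝ≥0) : ℝ≥0∞) * ((((φ 1).toNNReal⁻¹ : ℝ≥0) : ℝ≥0∞) * φ 1) := by
          rw [e4, mul_one]
      _ ≤ ((a ^ (p : ℝ) : ℝ≥0) : ℝ≥0∞) * ((((φ 1).toNNReal⁻¹ : ℝ≥0) : ℝ≥0∞) *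
            ((((l / a) ^ (p : ℝ) : ℝ≥0) : ℝ≥0∞) * φ (l⁻¹ * a))) := by gcongr
      _ = (((a ^ (p : ℝ) : ℝ≥0) : ℝ≥0∞) * (((l / a) ^ (p : ℝ) : ℝ≥0) : ℝ≥0∞)) *
            (((φ 1).toNNReal⁻¹ : ℝ≥0) : ℝ≥0∞) * φ (l⁻¹ * a) := by ring
      _ = _ := by rw [e3, ENNReal.coe_mul]
  calc ∫⁻ t, ((‖(x - x.radialTrunc l) t‖₊ ^ (p : ℝ) : ℝ≥0) : ℝ≥0∞) ∂μ
      ≤ ∫⁻ t, ((l ^ (p : ℝ) * (φ 1).toNNReal⁻¹ : ℝ≥0) : ℝ≥0∞) * φ (l⁻¹ * ‖x t‖₊) ∂μ := by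
        refine lintegral_mono_ae ?_
        filter_upwards [ae_nnnorm_sub_radialTrunc_le l x] with t ht
        refine le_trans ?_ (pt _)
        gcongr
    _ = ((l ^ (p : ℝ) * (φ 1).toNNReal⁻¹ : ℝ≥0) : ℝ≥0∞) *
          modular φ (((l⁻¹ : ℝ≥0) : ℝ) • x) := by
        rw [lintegral_const_mul' _ _ ENNReal.coe_ne_top, modular_coe_smul]
    _ ≤ ((l ^ (p : ℝ) * (φ 1).toNNReal⁻¹ : ℝ≥0) : ℝ≥0∞) * 1 := by gcongr
    _ = _ := mul_one _

theorem sub_radialTrunc_mem_lebesgue (hp : 1 ≤ p) (h0 : φ 0 = 0)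
    (hc : ConvexOn ℝ≥0 univ (fun u : ℝ≥0 => φ (u ^ (1 / (p : ℝ))))) (h1 : φ 1 ≠ ⊤)
    (h1' : φ 1 ≠ 0) {x : Ω →ₘ[μ] 𝕜} {l : ℝ≥0} (hl : 0 < l)
    (hx : modular φ (((l⁻¹ : ℝ≥0) : ℝ) • x) ≤ 1) :
    x - x.radialTrunc l ∈ (FnSpace.lebesgue 𝕜 μ p).carrier :=
  Lp.mem_Lp_iff_eLpNorm_lt_top.2
    ((eLpNorm_sub_radialTrunc_le hp h0 hc h1 h1' hl hx).trans_lt ENNReal.coe_lt_top)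

theorem orliczCarrier_subset_sum (hp : 1 ≤ p) (hφ : IsOrliczFunction φ)
    (hc : ConvexOn ℝ≥0 univ (fun u : ℝ≥0 => φ (u ^ (1 / (p : ℝ))))) (h1 : φ 1 ≠ ⊤)
    (h1' : φ 1 ≠ 0) :
    (orliczCarrier φ : Set (Ω →ₘ[μ] 𝕜)) ⊆
      FnSpace.sum (FnSpace.lebesgue 𝕜 μ p) (FnSpace.lebesgue 𝕜 μ ⊤) := by
  intro x hx
  obtain ⟨l, hl, -⟩ := ENNReal.lt_iff_exists_nnreal_btwn.1 ((mem_orliczCarrier_iff hφ x).1 hx)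
  have hpos : 0 < l := by exact_mod_cast zero_le.trans_lt hl
  exact ⟨_, sub_radialTrunc_mem_lebesgue hp hφ.map_zero hc h1 h1' hpos
    (modular_le_one_of_luxemburgNorm_lt hφ.mono hl), _, radialTrunc_mem_lebesgue_top l x,
    sub_add_cancel _ _⟩

theorem sumNrm_le_mul_luxemburgNorm (hp : 1 ≤ p) (h0 : φ 0 = 0)
    (hc : ConvexOn ℝ≥0 univ (fun u : ℝ≥0 => φ (u ^ (1 / (p : ℝ))))) (h1 : φ 1 ≠ ⊤)
    (h1' : φ 1 ≠ 0) (x : Ω →ₘ[μ] 𝕜) :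
    FnSpace.sumNrm (FnSpace.lebesgue 𝕜 μ p) (FnSpace.lebesgue 𝕜 μ ⊤) x ≤
      (((φ 1).toNNReal⁻¹ ^ (1 / (p : ℝ)) + 1 : ℝ≥0) : ℝ≥0∞) * luxemburgNorm φ x := by
  set d : ℝ≥0 := (φ 1).toNNReal⁻¹ ^ (1 / (p : ℝ)) with hd
  have hD0 : ((d + 1 : ℝ≥0) : ℝ≥0∞) ≠ 0 := by
    rw [ENNReal.coe_ne_zero]; positivity
  unfold luxemburgNorm
  rw [ENNReal.mul_iInf_of_ne hD0 ENNReal.coe_ne_top]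
  refine le_iInf fun l => ?_
  rw [ENNReal.mul_iInf_of_ne hD0 ENNReal.coe_ne_top]
  refine le_iInf fun hl => ?_
  rw [ENNReal.mul_iInf_of_ne hD0 ENNReal.coe_ne_top]
  refine le_iInf fun h => ?_
  lift l to ℝ≥0 using hl.le
  have hl' : 0 < l := by exact_mod_cast hl
  rw [← NNReal.coe_inv] at h
  rw [ENNReal.ofReal_coe_nnreal]
  refine (iInf₂_le_of_le _ (sub_radialTrunc_mem_lebesgue hp h0 hc h1 h1' hl' h)
    (iInf₂_le_of_le _ (radialTrunc_mem_lebesgue_top l x)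
      (iInf_le_of_le (sub_add_cancel _ _).symm le_rfl))).trans ?_
  calc eLpNorm (x - x.radialTrunc l) p μ + eLpNorm (x.radialTrunc l) ⊤ μ
      ≤ ((l * d : ℝ≥0) : ℝ≥0∞) + l :=
        add_le_add (eLpNorm_sub_radialTrunc_le hp h0 hc h1 h1' hl' h)
          (eLpNorm_top_radialTrunc_le l x)
    _ = _ := by
        rw [← ENNReal.coe_add, ← ENNReal.coe_mul]
        congr 1
        ring

/-- Substituting `l ↦ C l` in the infimum reduces the norm bound to the modular estimate at scale
`1/l`. -/
theorem weightedNorm_apply_le [SFinite μ] (hp : 1 ≤ p) (hm : Monotone φ) (h0 : φ 0 = 0)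
    (hl : IsLeftContinuous φ)
    (hc : ConvexOn ℝ≥0 univ (fun u : ℝ≥0 => φ (u ^ (1 / (p : ℝ))))) (hW : IsNormWeight W)
    {T : FnSpace.sum (FnSpace.lebesgue 𝕜 μ p) (FnSpace.lebesgue 𝕜 μ ⊤) →
      FnSpace.sum (FnSpace.lebesgue 𝕜 μ p) (FnSpace.lebesgue 𝕜 μ ⊤)}
    (hT : FnSpace.IsAdmissible T) {K : ℝ≥0} (hK : 0 < K) (hM : FnSpace.maxNrm T ≤ K)
    (x : FnSpace.sum (FnSpace.lebesgue 𝕜 μ p) (FnSpace.lebesgue 𝕜 μ ⊤)) :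
    weightedNorm φ W (T x).1 ≤
      ((2 ^ (1 - 1 / (p : ℝ)) * K : ℝ≥0) : ℝ≥0∞) * weightedNorm φ W x.1 := by
  set C : ℝ≥0 := 2 ^ (1 - 1 / (p : ℝ)) * K with hC
  have hCpos : 0 < C := mul_pos (rpow_two_one_sub_pos _) hK
  have hCe : (C : ℝ≥0∞) ≠ 0 := by simpa using hCpos.ne'
  conv_rhs => unfold weightedNorm
  rw [ENNReal.mul_iInf_of_ne hCe ENNReal.coe_ne_top]
  refine le_iInf fun l => ?_
  rw [ENNReal.mul_iInf_of_ne hCe ENNReal.coe_ne_top]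
  refine le_iInf fun hlpos => ?_
  refine (weightedNorm_le φ W (T x).1 (mul_pos hCpos hlpos)).trans ?_
  rw [ENNReal.coe_mul, mul_assoc]
  gcongr
  refine hW.mono ?_
  have key := modular_smul_apply_le hp hm h0 hl hc hT hK hM
    (c := ((l⁻¹ : ℝ≥0) : ℝ)) (by exact_mod_cast inv_pos.2 hlpos) x
  have e : ((l⁻¹ : ℝ≥0) : ℝ) * ((2 : ℝ) ^ (1 - 1 / (p : ℝ)) * K)⁻¹ =
      (((C * l)⁻¹ : ℝ≥0) : ℝ) := by
    rw [hC, mul_comm _ l, mul_inv l]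
    push_cast
    rfl
  rwa [e] at key

theorem isInterpolationSpace_weightedNorm [SFinite μ] (hp : 1 ≤ p) (hφ : IsOrliczFunction φ)
    (hl : IsLeftContinuous φ)
    (hc : ConvexOn ℝ≥0 univ (fun u : ℝ≥0 => φ (u ^ (1 / (p : ℝ))))) (h1 : φ 1 ≠ ⊤)
    (h1' : φ 1 ≠ 0) (hW : IsNormWeight W) :
    FnSpace.IsInterpolationSpace (FnSpace.lebesgue 𝕜 μ p) (FnSpace.lebesgue 𝕜 μ ⊤)
      ⟨orliczCarrier φ, weightedNorm φ W⟩ (2 ^ (1 - 1 / (p : ℝ))) where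
  banach := isBanach_weightedNorm hφ hl hW
  inter_subset x hx := by
    refine (mem_orliczCarrier_iff hφ x).2
      ((luxemburgNorm_le_mul_interNrm hp hφ hc h1 hx).trans_lt ?_)
    exact ENNReal.mul_lt_top ENNReal.coe_lt_top
      (max_lt (Lp.mem_Lp_iff_eLpNorm_lt_top.1 hx.1) (Lp.mem_Lp_iff_eLpNorm_lt_top.1 hx.2))
  inter_continuous := by
    refine ⟨(W 1).toNNReal * max 1 (φ 1).toNNReal, fun x hx => ?_⟩
    rw [ENNReal.coe_mul, ENNReal.coe_toNNReal hW.map_one, mul_assoc]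
    refine (weightedNorm_le_mul_luxemburgNorm hW x).trans ?_
    gcongr
    exact luxemburgNorm_le_mul_interNrm hp hφ hc h1 hx
  subset_sum := orliczCarrier_subset_sum hp hφ hc h1 h1'
  sum_continuous := by
    refine ⟨(φ 1).toNNReal⁻¹ ^ (1 / (p : ℝ)) + 1, fun x _ =>
      (sumNrm_le_mul_luxemburgNorm hp hφ.map_zero hc h1 h1' x).trans ?_⟩
    gcongr
    exact luxemburgNorm_le_weightedNorm hφ hW x
  mapsInto T hT x hx := by
    have hM : FnSpace.maxNrm T < ⊤ := max_lt hT.bounded₀ hT.bounded₁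
    have mem := mem_orliczCarrier_iff_weightedNorm (𝕜 := 𝕜) (μ := μ) hφ hW
    refine (mem _).2 ((weightedNorm_apply_le hp hφ.mono hφ.map_zero hl hc hW hT
      (K := (FnSpace.maxNrm T).toNNReal + 1) (by positivity) ?_ x).trans_lt
      (ENNReal.mul_lt_top ENNReal.coe_lt_top ((mem _).1 hx)))
    rw [ENNReal.coe_add, ENNReal.coe_toNNReal hM.ne]
    exact le_self_add
  opNrm_le T hT := by
    have hM : FnSpace.maxNrm T < ⊤ := max_lt hT.bounded₀ hT.bounded₁
    have hCpos := rpow_two_one_sub_pos (p : ℝ)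
    refine iSup₂_le fun x hx => iSup_le fun _ => ?_
    -- The bound requires `K > 0`, while `M` may be `0`; the excess `ε / 2^(1-1/p)` becomes `ε`
    -- after multiplication by the constant.
    refine ENNReal.le_of_forall_pos_le_add fun ε hε _ => ENNReal.div_le_of_le_mul ?_
    refine (weightedNorm_apply_le hp hφ.mono hφ.map_zero hl hc hW hT
      (K := (FnSpace.maxNrm T).toNNReal + ε / 2 ^ (1 - 1 / (p : ℝ)))
      (add_pos_of_nonneg_of_pos zero_le (div_pos hε hCpos)) ?_ x).trans_eq ?_
    · rw [ENNReal.coe_add, ENNReal.coe_toNNReal hM.ne]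
      exact le_self_add
    · congr 1
      rw [mul_add, mul_div_cancel₀ _ hCpos.ne', ENNReal.coe_add, ENNReal.coe_mul,
        ENNReal.coe_toNNReal hM.ne, ENNReal.coe_rpow_of_ne_zero two_ne_zero]
      rfl

end

/-! ### The main theorem -/

theorem mainTheorem1 {Ω : Type*} [MeasurableSpace Ω] (μ : Measure Ω) [SigmaFinite μ]
    (𝕜 : Type*) [RCLike 𝕜] (p : ℝ≥0) (hp : 1 ≤ p) (φ : ℝ≥0 → ℝ≥0∞) :
    -- (a) the modular estimate
    (IsOrliczFunction φ → IsLeftContinuous φ →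
      ConvexOn ℝ≥0 univ (fun u : ℝ≥0 => φ (u ^ (1 / (p : ℝ)))) →
      ∀ T : FnSpace.sum (FnSpace.lebesgue 𝕜 μ p) (FnSpace.lebesgue 𝕜 μ ⊤) →
          FnSpace.sum (FnSpace.lebesgue 𝕜 μ p) (FnSpace.lebesgue 𝕜 μ ⊤),
        FnSpace.IsAdmissible T →
        ∀ x, modular φ
            (((2 : ℝ) ^ (1 - 1 / (p : ℝ)) * (FnSpace.maxNrm T).toReal)⁻¹ • (T x).1) ≤
          modular φ x.1) ∧
    -- (b) interpolation with constant `2 ^ (1 - 1 / p)`, which is `1` for `p = 1`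
    (∀ ρ : ℝ≥0 → ℝ≥0, IsConcaveQuasiConcave ρ → rhoStar ρ '' Ioi 0 = Ioi 0 →
      φ 0 = 0 →
      (∀ u : ℝ≥0, 0 < u → φ (u ^ (1 / (p : ℝ)) * ρ (u ^ (-(1 / (p : ℝ))))) = u) →
      IsOrliczFunction φ ∧
      FnSpace.IsInterpolationSpace (FnSpace.lebesgue 𝕜 μ p) (FnSpace.lebesgue 𝕜 μ ⊤)
        (FnSpace.orliczLuxemburg 𝕜 μ φ) (2 ^ (1 - 1 / (p : ℝ))) ∧
      FnSpace.IsInterpolationSpace (FnSpace.lebesgue 𝕜 μ p) (FnSpace.lebesgue 𝕜 μ ⊤)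
        (FnSpace.orliczAmemiya 𝕜 μ φ) (2 ^ (1 - 1 / (p : ℝ))) ∧
      (p = 1 →
        FnSpace.IsInterpolationSpace (FnSpace.lebesgue 𝕜 μ 1) (FnSpace.lebesgue 𝕜 μ ⊤)
          (FnSpace.orliczLuxemburg 𝕜 μ φ) 1 ∧
        FnSpace.IsInterpolationSpace (FnSpace.lebesgue 𝕜 μ 1) (FnSpace.lebesgue 𝕜 μ ⊤)
          (FnSpace.orliczAmemiya 𝕜 μ φ) 1)) := by
  refine ⟨fun hφ hl hc T hT x => ?_, fun ρ hρ hrange h0 h => ?_⟩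
  · have hM : FnSpace.maxNrm T < ⊤ := max_lt hT.bounded₀ hT.bounded₁
    -- For `M = 0` the convention `0⁻¹ = 0` makes the left-hand side the integral of `φ 0 = 0`.
    rcases eq_or_ne (FnSpace.maxNrm T).toNNReal 0 with hz | hz
    · have hz' : (FnSpace.maxNrm T).toReal = ((0 : ℝ≥0) : ℝ) := by rw [← hz]; rfl
      rw [hz', NNReal.coe_zero, mul_zero, inv_zero, modular_smul]
      simp [hφ.map_zero]
    · have key := modular_smul_apply_le hp hφ.mono hφ.map_zero hl hc hT
        (K := (FnSpace.maxNrm T).toNNReal) (pos_iff_ne_zero.2 hz)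
        (ENNReal.coe_toNNReal hM.ne).ge one_pos x
      rwa [one_mul, show (1 : ℝ) • x.1 = x.1 from one_smul ℝ x.1] at key
  · have hp' : (1 : ℝ) ≤ p := by exact_mod_cast hp
    have hmap := map_rhoStar_eq_rpow hp' h0 h
    have hs := strictMono_rhoStar hρ.1 hp' hmap
    have hsurj := surjective_rhoStar hrange
    have hφ := isOrliczFunction_of_map_rhoStar hρ hp' hs hsurj h0 hmap
    have hl : IsLeftContinuous φ := fun u =>
      (continuous_of_map_rhoStar hp' hs hsurj hmap).continuousWithinAt
    have hc := convexOn_rpow_of_map_rhoStar hρ hp' hφ.mono hsurj hmap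
    -- Writing `1 = ρ_*(w)` with `w ≠ 0` gives `φ 1 = w^p`, finite and nonzero, as the embeddings
    -- require.
    obtain ⟨w, hw⟩ := hsurj 1
    have hw0 : w ≠ 0 := by
      rintro rfl
      rw [rhoStar_zero] at hw
      exact zero_ne_one hw
    have h1 : φ 1 ≠ ⊤ := by rw [← hw, hmap]; exact ENNReal.coe_ne_top
    have h1' : φ 1 ≠ 0 := by
      rw [← hw, hmap, ENNReal.coe_ne_zero]
      exact (NNReal.rpow_pos (pos_iff_ne_zero.2 hw0)).ne'
    have eL : FnSpace.orliczLuxemburg 𝕜 μ φ = ⟨orliczCarrier φ, weightedNorm φ luxemburgWeight⟩ := by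
      rw [FnSpace.orliczLuxemburg, funext (luxemburgNorm_eq_weightedNorm (𝕜 := 𝕜) (μ := μ) φ)]
    have eA : FnSpace.orliczAmemiya 𝕜 μ φ = ⟨orliczCarrier φ, weightedNorm φ (fun a => 1 + a)⟩ := by
      rw [FnSpace.orliczAmemiya, funext (orliczNorm_eq_weightedNorm (𝕜 := 𝕜) (μ := μ) φ)]
    rw [eL, eA]
    have hL := isInterpolationSpace_weightedNorm (𝕜 := 𝕜) (μ := μ) hp hφ hl hc h1 h1'
      isNormWeight_luxemburgWeight
    have hA := isInterpolationSpace_weightedNorm (𝕜 := 𝕜) (μ := μ) hp hφ hl hc h1 h1'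
      isNormWeight_one_add
    refine ⟨hφ, hL, hA, ?_⟩
    rintro rfl
    have e : (2 : ℝ≥0∞) ^ (1 - 1 / ((1 : ℝ≥0) : ℝ)) = 1 := by simp
    rw [e, ENNReal.coe_one] at hL hA
    exact ⟨hL, hA⟩
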